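/- Let $d\ge 3$, $b\in\mathbb R$, and $\eta=\mathrm{diag}(-1,1,\dots,1)$ on $\mathbb R^d$, $p\cdot x=\eta_{\mu\nu}p^\mu x^\nu$. **Oscillators.** Let $\mathcal F_0$ be the span of the vectors $\alpha^{\mu_1}_{-m_1}\cdots\alpha^{\mu_k}_{-m_k}\Omega$ ($m_i>0$), where $[\alpha^\mu_m,\alpha^\nu_n]=m\,\eta^{\mu\nu}\delta_{m+n,0}$ ($m,n\ne0$) and $\alpha^\mu_m\Omega=0$ for $m>0$; let $\langle\cdot,\cdot\rangle=(\cdot,J\cdot)$ be the hermitian form with $\langle\Omega,\Omega\rangle=1$ and $\langle\alpha^\mu_n\phi,\psi\rangle=\langle\phi,\alpha^\mu_{-n}\psi\rangle$, where $J$ multiplies $\alpha^{\mu_1}_{-m_1}\cdots\alpha^{\mu_k}_{-m_k}\Omega$ by $\prod_i\eta^{\mu_i\mu_i}$, and let $\mathcal F$ be the Hilbert space completion of $\mathcal F_0$ for $(\cdot,\cdot)$. For $p\in\mathbb R^d$ put $\alpha^\mu_0=p^\mu$ and let $L_m(p)=\frac12\sum_{n\in\mathbb Z}{:}\alpha_{m-n}\cdot\alpha_n{:}-b\,\delta_{m,0}$,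 $N=\frac12\sum_{n\neq0}{:}\alpha_{-n}\cdot\alpha_n{:}$, $M^2=2(N-b)$; operators on $\mathcal F_0$ are identified with their closures in $\mathcal F$. Let $P_r$ be the orthogonal projection of $\mathcal F$ onto the eigenspace $M^2=r$; the spectrum of $M^2$ is $\{2(n-b):n=0,1,2,\dots\}$ (that is $\{-2,0,2,\dots\}$ for $b=1$). **One-string space.** For $r\ge0$ let $V_r^{(+)}=\{p\ne0:p^2+r=0,\ p^0>0\}$, for $r<0$ let $V_r^{(+)}=\{p:p^2+r=0\}$, with the Lorentz invariant measure $d\mu_r=d\mathbf p/(2\sqrt{\mathbf p^2+r})$. Let $\mathcal H=\bigoplus_{r\in\operatorname{spec}M^2}L^2(V_r^{(+)},\mathcal F,d\mu_r)$ with the indefinite inner product $\langle\psi,\phi\rangle=\sum_r\int\langle\psi_r(p),\phi_r(p)\rangle\,d\mu_r(p)$. Let $\mathcal H_+$ be the part with $r\ge0$, let $\mathcal H'$ be the set of $\psi\in\mathcal H$ such that for every $r$ and almost every $p$ one has $(-r+M^2)\psi_r(p)=0$ and $L_m(p)\psi_r(p)=0$ for all $m>0$, and put $\mathcal H'_+=\mathcal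 H'\cap\mathcal H_+$, $\mathcal H''=\mathcal H'\cap(\mathcal H')^{\perp}$ (orthogonality for $\langle\cdot,\cdot\rangle$). **Test functions.** For $F\in\mathscr S(\mathbb R^d,\mathcal F)$ let $\hat F(p)=(2\pi)^{-d/2}\int e^{-ip\cdot x}F(x)\,dx$, and let $\Pi F$ denote the vector of $\mathcal H_+$ with $(\Pi F)_r=\sqrt{2\pi}\,P_r\hat F|_{V_r^{(+)}}$ for $r\ge0$ (if it exists). $F$ is *constrained* if $\Pi F\in\mathcal H'_+$. $F$ is *real* if $\hat F(p^0,\mathbf p)=C_1\hat F(p^0,-\mathbf p)$ for all $p$, where $C_1$ is the antilinear involution of $\mathcal F$ with $C_1\Omega=\Omega$, $C_1\alpha^0_nC_1=\alpha^0_n$, $C_1\alpha^i_nC_1=-\alpha^i_n$ ($1\le i\le d-1$, $n\ne0$). $\mathscr S(\mathbb R^d,\mathcal F_0)=\mathscr S(\mathbb R^d)\otimes\mathcal F_0$ is the space of finite sums $\sum_i f_i\otimes\chi_i$, $f_i\in\mathscr S(\mathbb R^d)$, $\chi_i\in\mathcal F_0$. The Lorentz group acts on $\mathcal F_0$ by $u(\Lambda)\Omega=\Omega$,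 $u(\Lambda)^{-1}\alpha^\mu_mu(\Lambda)=\Lambda^\mu{}_\nu\alpha^\nu_m$. **String field.** On finite particle vectors, the linear combinations of vectors $a^\dagger(f_1)\cdots a^\dagger(f_k)\Omega$ with $f_i\in\mathcal H_+$, where $[a(f),a^\dagger(g)]=\langle f,g\rangle$, $[a(f),a(g)]=[a^\dagger(f),a^\dagger(g)]=0$ and $a(f)\Omega=0$, put $\Phi(F)=\frac1{\sqrt2}(a^\dagger(\Pi F)+a(\Pi F))$. Let $\mathscr K'$ be the span of such vectors with all $f_i\in\mathcal H'_+$, and $\mathscr K''=\mathscr K'\cap(\mathscr K')^\perp$. **Theorem.** 1. For every integer $n\ge0$ with $r=2(n-b)\ge0$ and every $R>0$ there is a real constrained test function $F\in\mathscr S(\mathbb R^d,\mathcal F_0)$ with support in the Euclidean ball $\{|x|\le R\}$, such that $\Pi F$ exists, has only the component of squared mass $r$, and is not in $\mathcal H''$. The field $\Phi(F)$ maps $\mathscr K'$ into $\mathscr K'$ and $\mathscr K''$ into $\mathscr K''$, and the operator that it induces on $\mathscr K'/\mathscr K''$ is not zero. 2. For every $F\in\mathscr S(\mathbb R^d,\mathcal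 F_0)$ (in particular for those in part 1), every $a\in\mathbb R^d$ and every $\Lambda$ in the full Lorentz group, the Poincaré transform $F_{a,\Lambda}(x)=u(\Lambda)F(\Lambda^{-1}(x-a))$ is a well defined element of $\mathscr S(\mathbb R^d,\mathcal F_0)$. -/

import Mathlib

open MeasureTheory
open scoped SchwartzMap ComplexConjugate

noncomputable section

namespace StringField

/-! ### Minkowski space with `s` space dimensions; the space-time dimension is `d = s + 1` -/

/-- Space-time (and momentum space) `ℝ^d`, with the time coordinate at index `0`. The Euclidean
structure is used for Lebesgue measure, balls and Schwartz functions only. -/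
abbrev Spacetime (s : ℕ) := EuclideanSpace ℝ (Fin (s + 1))

/-- The diagonal entries of the metric tensor `η = diag(-1, 1, …, 1)`. -/
def eta {s : ℕ} (μ : Fin (s + 1)) : ℝ := if μ = 0 then -1 else 1

/-- The Minkowski product `p · x = η_{μν} p^μ x^ν`. -/
def minkowski {s : ℕ} (p x : Spacetime s) : ℝ := ∑ μ, eta μ * p μ * x μ

/-- The point `(t, q)` of space-time with time coordinate `t` and space coordinates `q`. -/
def event {s : ℕ} (t : ℝ) (q : EuclideanSpace ℝ (Fin s)) : Spacetime s :=
  WithLp.toLp 2 (Fin.cons t fun i => q i)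

/-- Space reflection `(p⁰, 𝐩) ↦ (p⁰, -𝐩)`. -/
def spaceReflection {s : ℕ} (p : Spacetime s) : Spacetime s :=
  WithLp.toLp 2 fun μ => if μ = 0 then p μ else -p μ

/-! ### The algebraic oscillator Fock space -/

/-- Labels `(m, μ)` of the creation operators `α^μ_{-m}`, `m > 0`. -/
abbrev Mode (s : ℕ) := ℕ+ × Fin (s + 1)

/-- The algebraic Fock space `𝓕₀`: the polynomial `∏ X_(m_i, μ_i)` stands for the vector
`α^{μ_1}_{-m_1} ⋯ α^{μ_k}_{-m_k} Ω`, and the vacuum `Ω` is the polynomial `1`. -/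
abbrev Fock₀ (s : ℕ) := MvPolynomial (Mode s) ℂ

/-- The oscillators `α^μ_n` on `𝓕₀`, with the convention `α^μ_0 = p^μ`: for `m > 0`, `α^μ_{-m}` is
multiplication by `X_(m, μ)`, and `α^μ_m` is `m η^{μμ} ∂/∂X_(m, μ)`, so that
`[α^μ_m, α^ν_n] = m η^{μν} δ_{m+n}` and `α^μ_m Ω = 0` for `m > 0`. -/
def alpha {s : ℕ} (p : Spacetime s) : ℤ → Fin (s + 1) → Module.End ℂ (Fock₀ s)
  | Int.ofNat 0, μ => (p μ : ℂ) • LinearMap.id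
  | Int.ofNat (k + 1), μ =>
      (((k + 1 : ℕ) : ℂ) * (eta μ : ℂ)) • (MvPolynomial.pderiv (k.succPNat, μ)).toLinearMap
  | Int.negSucc k, μ => LinearMap.mulLeft ℂ (MvPolynomial.X (k.succPNat, μ))

/-- The Wick ordered product `:α^μ_k α^μ_l:` (the larger index stands to the right). -/
def wick {s : ℕ} (p : Spacetime s) (k l : ℤ) (μ : Fin (s + 1)) : Module.End ℂ (Fock₀ s) :=
  if k ≤ l then alpha p k μ ∘ₗ alpha p l μ else alpha p l μ ∘ₗ alpha p k μ

/-- `½ ∑_{n ∈ ℤ} :α_{m-n} · α_n:` applied to `χ ∈ 𝓕₀`; only finitely many terms are nonzero, see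
`finite_support_wick`. -/
def wickSum {s : ℕ} (p : Spacetime s) (m : ℤ) (χ : Fock₀ s) : Fock₀ s :=
  (1 / 2 : ℂ) • ∑ᶠ n : ℤ, ∑ μ, (eta μ : ℂ) • wick p (m - n) n μ χ

theorem alpha_eventually_zero {s : ℕ} (p : Spacetime s) (χ : Fock₀ s) :
    ∃ M : ℕ, ∀ n : ℤ, (M : ℤ) < n → ∀ μ, alpha p n μ χ = 0 := by
  refine ⟨χ.vars.sup fun i => (i.1 : ℕ), ?_⟩
  intro n hn μ
  match n, hn with
  | Int.ofNat 0, hn =>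
    exfalso
    simp only [Int.ofNat_eq_natCast, Nat.cast_lt] at hn
    omega
  | Int.ofNat (k + 1), hn =>
    have h : (k.succPNat, μ) ∉ χ.vars := by
      intro h
      have h1 := Finset.le_sup (f := fun i : Mode s => (i.1 : ℕ)) h
      have h2 : (((k.succPNat, μ) : Mode s).1 : ℕ) = k + 1 := rfl
      simp only [Int.ofNat_eq_natCast, Nat.cast_lt] at hn
      rw [h2] at h1
      omega
    simp [alpha, MvPolynomial.pderiv_eq_zero_of_notMem_vars h]
  | Int.negSucc k, hn =>
    exfalso
    have := Int.negSucc_lt_zero k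
    omega

theorem finite_support_wick {s : ℕ} (p : Spacetime s) (m : ℤ) (χ : Fock₀ s) :
    (Function.support fun n : ℤ => ∑ μ, (eta μ : ℂ) • wick p (m - n) n μ χ).Finite := by
  obtain ⟨M, hM⟩ := alpha_eventually_zero p χ
  refine (Set.finite_Icc (m - M) (M : ℤ)).subset ?_
  intro n hn
  by_contra h
  apply hn
  refine Finset.sum_eq_zero fun μ _ => ?_
  rw [Set.mem_Icc, not_and_or] at h
  unfold wick
  split_ifs with hle
  · rw [LinearMap.comp_apply, hM n (by omega), map_zero, smul_zero]
  · rw [LinearMap.comp_apply, hM (m - n) (by omega), map_zero, smul_zero]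

/-- The constraint operator `L_m(p) = ½ ∑_{n ∈ ℤ} :α_{m-n} · α_n: - b δ_m` on the fibre `𝓕₀` over
the momentum `p`. -/
def virasoro {s : ℕ} (b : ℝ) (p : Spacetime s) (m : ℤ) (χ : Fock₀ s) : Fock₀ s :=
  wickSum p m χ - (if m = 0 then (b : ℂ) else 0) • χ

/-- The operator `N = ½ ∑_{n ≠ 0} :α_{-n} · α_n:`. -/
def number {s : ℕ} (χ : Fock₀ s) : Fock₀ s := wickSum 0 0 χ

/-- The squared mass operator `M² = 2 (N - b)`. -/
def massSq {s : ℕ} (b : ℝ) (χ : Fock₀ s) : Fock₀ s := (2 : ℂ) • (number χ - (b : ℂ) • χ)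

/-- The representation `u(Λ)` of the Lorentz group on `𝓕₀`: `u(Λ) Ω = Ω` and
`u(Λ)⁻¹ α^μ_m u(Λ) = Λ^μ_ν α^ν_m`, that is `u(Λ) α^μ_m u(Λ)⁻¹ = (Λ⁻¹)^μ_ν α^ν_m`. -/
def lorentzRep {s : ℕ} (Λ : Matrix (Fin (s + 1)) (Fin (s + 1)) ℝ) : Fock₀ s →ₐ[ℂ] Fock₀ s :=
  MvPolynomial.aeval fun i : Mode s =>
    ∑ ν, MvPolynomial.C ((Λ⁻¹ i.2 ν : ℝ) : ℂ) * MvPolynomial.X (i.1, ν)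

/-- Membership in the full Lorentz group, `Λᵀ η Λ = η`. -/
def IsLorentz {s : ℕ} (Λ : Matrix (Fin (s + 1)) (Fin (s + 1)) ℝ) : Prop :=
  Λ.transpose * Matrix.diagonal eta * Λ = Matrix.diagonal eta

/-! ### The Krein space completion of the oscillator Fock space -/

/-- The completion `𝓕` of `𝓕₀` in the scalar product `(·, ·)`, in coordinates with respect to the
orthonormal basis of normalized occupation number vectors. -/
abbrev FockSpace (s : ℕ) := lp (fun _ : Mode s →₀ ℕ => ℂ) 2

/-- `(v, v)` for the vector `v = ∏ (α^μ_{-m})^{k(m, μ)} Ω`, namely `∏ m^{k(m, μ)} k(m, μ)!`. -/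
def occNormSq {s : ℕ} (k : Mode s →₀ ℕ) : ℝ :=
  k.prod fun i e => ((i.1 : ℕ) : ℝ) ^ e * (e.factorial : ℝ)

/-- The inclusion `𝓕₀ → 𝓕`. -/
def embed {s : ℕ} : Fock₀ s →ₗ[ℂ] FockSpace s where
  toFun χ := ⟨fun k => (Real.sqrt (occNormSq k) : ℂ) * χ.coeff k, by
    have h : Memℓp (fun k : Mode s →₀ ℕ => (Real.sqrt (occNormSq k) : ℂ) * χ.coeff k) 0 := by
      refine memℓp_zero (χ.support.finite_toSet.subset ?_)
      intro k hk
      simp only [Set.mem_ofPred_eq, ne_eq, mul_eq_zero, not_or] at hk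
      exact MvPolynomial.mem_support_iff.mpr hk.2
    exact h.of_exponent_ge zero_le⟩
  map_add' χ ξ := by
    ext k
    change _ * MvPolynomial.coeff k (χ + ξ) = _ * MvPolynomial.coeff k χ + _ * MvPolynomial.coeff k ξ
    rw [MvPolynomial.coeff_add, mul_add]
  map_smul' c χ := by
    ext k
    change _ * MvPolynomial.coeff k (c • χ) = c * (_ * MvPolynomial.coeff k χ)
    rw [MvPolynomial.coeff_smul, smul_eq_mul]
    ring

/-- The direct sum of a family of contractions on a Hilbert sum. -/
def diagOp {ι : Type} {E : ι → Type} [∀ i, NormedAddCommGroup (E i)]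
    [∀ i, InnerProductSpace ℂ (E i)] (T : ∀ i, E i →L[ℂ] E i) (hT : ∀ i x, ‖T i x‖ ≤ ‖x‖) :
    lp E 2 →L[ℂ] lp E 2 :=
  LinearMap.mkContinuous
    { toFun := fun v => ⟨fun i => T i (v i), (lp.memℓp v).mono' fun i => hT i (v i)⟩
      map_add' := fun v w => by
        ext i
        exact map_add (T i) (v i) (w i)
      map_smul' := fun c v => by
        ext i
        exact map_smul (T i) c (v i) } 1 (fun v => by
        rw [one_mul]
        exact lp.norm_mono (by norm_num) fun i => hT i (v i))

/-- Multiplication of the coordinates by signs. -/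
def signOp {ι : Type} (ε : ι → ℝ) (hε : ∀ k, |ε k| = 1) :
    lp (fun _ : ι => ℂ) 2 →L[ℂ] lp (fun _ : ι => ℂ) 2 :=
  diagOp (fun k => (ε k : ℂ) • ContinuousLinearMap.id ℂ ℂ) fun k x => by simp [hε k]

/-- The sign `∏ (η^{μμ})^{k(m, μ)}` by which the fundamental symmetry acts on the occupation number
vector `k`. -/
def timeSign {s : ℕ} (k : Mode s →₀ ℕ) : ℝ := k.prod fun i e => eta i.2 ^ e

/-- The sign `∏ (-η^{μμ})^{k(m, μ)}`: a factor `-1` for every space-like oscillator. -/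
def spaceSign {s : ℕ} (k : Mode s →₀ ℕ) : ℝ := k.prod fun i e => (-eta i.2) ^ e

theorem abs_timeSign {s : ℕ} (k : Mode s →₀ ℕ) : |timeSign k| = 1 := by
  unfold timeSign Finsupp.prod
  rw [Finset.abs_prod]
  refine Finset.prod_eq_one fun i _ => ?_
  rw [abs_pow]
  unfold eta
  split_ifs <;> simp

theorem abs_spaceSign {s : ℕ} (k : Mode s →₀ ℕ) : |spaceSign k| = 1 := by
  unfold spaceSign Finsupp.prod
  rw [Finset.abs_prod]
  refine Finset.prod_eq_one fun i _ => ?_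
  rw [abs_pow]
  unfold eta
  split_ifs <;> simp

/-- The fundamental symmetry `J` of `𝓕`; the indefinite form is `⟨v, w⟩ = (v, J w)`. -/
def fundSymm (s : ℕ) : FockSpace s →L[ℂ] FockSpace s := signOp timeSign abs_timeSign

/-- The antilinear conjugation of `𝓕` fixing `Ω`, commuting with all `α^0_n` and anticommuting with
all `α^i_n`, `i ≥ 1` (`n ≠ 0`). -/
def fibreConj {s : ℕ} (v : FockSpace s) : FockSpace s :=
  signOp spaceSign abs_spaceSign (star v)

/-- The graph of the closure in `𝓕` of an operator `T` with domain `𝓕₀`: the pairs `(v, w)` with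
`v` in the domain of the closure, and `w` the value of the closure at `v`. -/
def closedGraph {s : ℕ} (T : Fock₀ s → Fock₀ s) : Set (FockSpace s × FockSpace s) :=
  closure (Set.range fun χ => (embed χ, embed (T χ)))

/-- The orthogonal projection `P_r` of `𝓕` onto the eigenspace `M² = r`. -/
def massProj {s : ℕ} (b r : ℝ) : FockSpace s →L[ℂ] FockSpace s :=
  (Submodule.span ℂ (embed '' {χ : Fock₀ s | massSq b χ = (r : ℂ) • χ})).topologicalClosure
    |>.starProjection

/-! ### The one-string space -/

/-- The image of the measure `d𝐩 / (2 ω_r(𝐩))`, `ω_r(𝐩) = √(𝐩² + r)`, on `{𝐩² + r > 0}` under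
`𝐩 ↦ (ε ω_r(𝐩), 𝐩)`. -/
def halfShellMeasure (s : ℕ) (ε r : ℝ) : Measure (Spacetime s) :=
  (((volume : Measure (EuclideanSpace ℝ (Fin s))).restrict {q | 0 < ‖q‖ ^ 2 + r}).withDensity
    fun q => ENNReal.ofReal (1 / (2 * Real.sqrt (‖q‖ ^ 2 + r)))).map
    fun q => event (ε * Real.sqrt (‖q‖ ^ 2 + r)) q

/-- The Lorentz invariant measure `μ_r` on the mass shell `p² + r = 0`, `p ≠ 0`: on the positive
energy half for `r ≥ 0`, on the whole one-sheeted hyperboloid for `r < 0`. -/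
def shellMeasure (s : ℕ) (r : ℝ) : Measure (Spacetime s) :=
  if 0 ≤ r then halfShellMeasure s 1 r else halfShellMeasure s 1 r + halfShellMeasure s (-1) r

/-- The eigenvalues `2 (n - b)`, `n = 0, 1, …`, of `M²`; these are `-2, 0, 2, …` for `b = 1`. -/
def massLevel (b : ℝ) (n : ℕ) : ℝ := 2 * ((n : ℝ) - b)

/-- The Krein space `𝓚_r = L²(V_r^{(+)}, 𝓕, dμ_r)` for `r = massLevel b n`. -/
abbrev KSpace (s : ℕ) (b : ℝ) (n : ℕ) := Lp (FockSpace s) 2 (shellMeasure s (massLevel b n))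

/-- The one-string Krein space, the Hilbert sum of the spaces `𝓚_r`. -/
abbrev OneString (s : ℕ) (b : ℝ) := lp (fun n : ℕ => KSpace s b n) 2

/-- The fundamental symmetry of `𝓚_r`, acting fibrewise. -/
def fundSymmK (s : ℕ) (b : ℝ) (n : ℕ) : KSpace s b n →L[ℂ] KSpace s b n :=
  (fundSymm s).compLpL 2 (shellMeasure s (massLevel b n))

theorem norm_fundSymm_le (s : ℕ) : ‖fundSymm s‖ ≤ 1 := by
  unfold fundSymm signOp diagOp
  exact LinearMap.mkContinuous_norm_le _ zero_le_one _

theorem norm_fundSymmK_le {s : ℕ} {b : ℝ} (n : ℕ) (f : KSpace s b n) :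
    ‖fundSymmK s b n f‖ ≤ ‖f‖ := by
  have h := ContinuousLinearMap.norm_compLp_le (fundSymm s) f
  calc ‖fundSymmK s b n f‖ ≤ ‖fundSymm s‖ * ‖f‖ := h
    _ ≤ 1 * ‖f‖ := by
      gcongr
      exact norm_fundSymm_le s
    _ = ‖f‖ := one_mul _

/-- The fundamental symmetry `J` of the one-string space. -/
def fundSymmH (s : ℕ) (b : ℝ) : OneString s b →L[ℂ] OneString s b :=
  diagOp (fundSymmK s b) norm_fundSymmK_le

/-- The indefinite inner product `⟨ψ, φ⟩ = (ψ, J φ)` of the one-string space. -/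
def krein {s : ℕ} {b : ℝ} (ψ φ : OneString s b) : ℂ := inner ℂ ψ (fundSymmH s b φ)

/-- The constraints on a vector `v` of the fibre over a momentum `p` of the mass shell `V_r`:
`(-r + M²) v = 0`, and `L_m(p) v = 0` for all `m > 0`. -/
def IsPhysicalAt {s : ℕ} (b r : ℝ) (p : Spacetime s) (v : FockSpace s) : Prop :=
  (v, 0) ∈ closedGraph (fun χ : Fock₀ s => massSq b χ - (r : ℂ) • χ) ∧
    ∀ m : ℤ, 0 < m → (v, 0) ∈ closedGraph (virasoro b p m)

/-- The space `𝓗'` of physical one-string vectors. -/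
def physical (s : ℕ) (b : ℝ) : Set (OneString s b) :=
  {ψ | ∀ n, ∀ᵐ p ∂(shellMeasure s (massLevel b n)), IsPhysicalAt b (massLevel b n) p (ψ n p)}

/-- The space `𝓗'' = 𝓗' ∩ (𝓗')^⊥` of spurious one-string vectors. -/
def spurious (s : ℕ) (b : ℝ) : Set (OneString s b) :=
  {ψ | ψ ∈ physical s b ∧ ∀ φ ∈ physical s b, krein φ ψ = 0}

/-- The tachyon free part `𝓗_+ = ∑_{r ≥ 0} 𝓚_r`. -/
def OneStringPos (s : ℕ) (b : ℝ) : Submodule ℂ (OneString s b) where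
  carrier := {ψ | ∀ n, massLevel b n < 0 → ψ n = 0}
  add_mem' := fun hψ hφ n hn => by simp [hψ n hn, hφ n hn]
  zero_mem' := fun _ _ => rfl
  smul_mem' := fun c ψ hψ n hn => by simp [hψ n hn]

/-- `𝓗'_+ = 𝓗' ∩ 𝓗_+`, as a subset of `𝓗_+`. -/
def physicalPos (s : ℕ) (b : ℝ) : Set (OneStringPos s b) := {ψ | (ψ : OneString s b) ∈ physical s b}

/-! ### Test functions -/

/-- The Fourier transform `F̂(p) = (2π)^{-d/2} ∫ e^{-i p·x} F(x) dx`, `d = s + 1`. -/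
def fourier {s : ℕ} (F : 𝓢(Spacetime s, FockSpace s)) (p : Spacetime s) : FockSpace s :=
  (((2 * Real.pi) ^ (-((s : ℝ) + 1) / 2) : ℝ) : ℂ) •
    ∫ x, Complex.exp (-Complex.I * (minkowski p x : ℂ)) • F x

/-- `F ∈ 𝓢(ℝ^d) ⊗ 𝓕₀`, the test functions with values in `𝓕₀`. -/
def IsAlgebraic {s : ℕ} (F : 𝓢(Spacetime s, FockSpace s)) : Prop :=
  ∃ (k : ℕ) (f : Fin k → 𝓢(Spacetime s, ℂ)) (χ : Fin k → Fock₀ s),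
    ∀ x, F x = ∑ i, f i x • embed (χ i)

/-- `Π F = ψ`, where `Π F ∈ 𝓗_+` is the vector whose restriction to `V_r`, `r ≥ 0`, is
`√(2π) P_r F̂`. -/
def IsProjection {s : ℕ} {b : ℝ} (F : 𝓢(Spacetime s, FockSpace s)) (ψ : OneStringPos s b) : Prop :=
  ∀ n, 0 ≤ massLevel b n →
    ((ψ : OneString s b) n : Spacetime s → FockSpace s)
      =ᵐ[shellMeasure s (massLevel b n)]
        fun p => (Real.sqrt (2 * Real.pi) : ℂ) • massProj b (massLevel b n) (fourier F p)

/-- `F` is constrained: `Π F ∈ 𝓗'_+`. -/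
def IsConstrained {s : ℕ} (b : ℝ) (F : 𝓢(Spacetime s, FockSpace s)) : Prop :=
  ∃ ψ ∈ physicalPos s b, IsProjection F ψ

/-- Reality `C₁ F̂ = F̂`, where `C₁` is the conjugation `(C₁ g)(p⁰, 𝐩) = C₁ g(p⁰, -𝐩)` of
`𝓕`-valued functions of the momentum; it satisfies `C₁ α^0_n C₁ = α^0_n` and
`C₁ α^i_n C₁ = -α^i_n` for all `n`, including `α^μ_0 = p^μ`. -/
def IsReal {s : ℕ} (F : 𝓢(Spacetime s, FockSpace s)) : Prop :=
  ∀ p, fibreConj (fourier F (spaceReflection p)) = fourier F p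

/-- `G = F_{a,Λ}`, that is `G(x) = u(Λ) F(Λ⁻¹ (x - a))`, for test functions `F` with values in
`𝓕₀`, on which `u(Λ)` is defined. -/
def IsPoincareTransform {s : ℕ} (a : Spacetime s) (Λ : Matrix (Fin (s + 1)) (Fin (s + 1)) ℝ)
    (F G : 𝓢(Spacetime s, FockSpace s)) : Prop :=
  ∀ x, ∃ χ : Fock₀ s,
    F (Matrix.toEuclideanLin Λ⁻¹ (x - a)) = embed χ ∧ G x = embed (lorentzRep Λ χ)

/-! ### The free string field and the physical Fock space -/

/-- The finite particle vectors over `𝓗_+`: `ι f_1 ⋯ ι f_n` stands for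
`a†(f_1) ⋯ a†(f_n) Ω`, and `1` for the vacuum. -/
abbrev FiniteParticle (s : ℕ) (b : ℝ) := SymmetricAlgebra ℂ (OneStringPos s b)

/-- The creation operator `a†(f)`. -/
def create {s : ℕ} {b : ℝ} (f : OneStringPos s b) : Module.End ℂ (FiniteParticle s b) :=
  LinearMap.mulLeft ℂ (SymmetricAlgebra.ι ℂ (OneStringPos s b) f)

/-- The linear functional `g ↦ ⟨f, g⟩` on `𝓗_+`. -/
def kreinFunctional {s : ℕ} {b : ℝ} (f : OneStringPos s b) : OneStringPos s b →ₗ[ℂ] ℂ :=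
  ((innerSL ℂ (f : OneString s b)).toLinearMap ∘ₗ (fundSymmH s b).toLinearMap) ∘ₗ
    (OneStringPos s b).subtype

/-- The derivation of a symmetric algebra with `ι g ↦ φ g`, obtained as the `ε`-component of the
algebra map `ι g ↦ ι g + φ g ε` to dual numbers. -/
def contract {V : Type} [AddCommGroup V] [Module ℂ V] (φ : V →ₗ[ℂ] ℂ) :
    Module.End ℂ (SymmetricAlgebra ℂ V) :=
  let A := SymmetricAlgebra ℂ V
  ((TrivSqZeroExt.sndHom A A).restrictScalars ℂ) ∘ₗ
    (SymmetricAlgebra.lift (A := DualNumber A)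
      ((TrivSqZeroExt.inlAlgHom ℂ A A).toLinearMap ∘ₗ SymmetricAlgebra.ι ℂ V +
        ((TrivSqZeroExt.inrHom A A).restrictScalars ℂ) ∘ₗ Algebra.linearMap ℂ A ∘ₗ φ)).toLinearMap

/-- The annihilation operator `a(f)`: the derivation with `a(f) Ω = 0` and
`a(f) a†(g) Ω = ⟨f, g⟩ Ω`. -/
def annihilate {s : ℕ} {b : ℝ} (f : OneStringPos s b) : Module.End ℂ (FiniteParticle s b) :=
  contract (kreinFunctional f)

/-- The string field `Φ = (a†(f) + a(f)) / √2`, where `f = Π F`, on finite particle vectors. -/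
def stringField {s : ℕ} {b : ℝ} (f : OneStringPos s b) : Module.End ℂ (FiniteParticle s b) :=
  ((1 / Real.sqrt 2 : ℝ) : ℂ) • (create f + annihilate f)

/-- The finite particle vectors in `𝓚' = Γ(𝓗'_+)`. -/
def physicalFock (s : ℕ) (b : ℝ) : Subalgebra ℂ (FiniteParticle s b) :=
  Algebra.adjoin ℂ (SymmetricAlgebra.ι ℂ (OneStringPos s b) '' physicalPos s b)

/-- The finite particle vectors in `𝓚'' = 𝓚' ∩ (𝓚')^⊥`. Orthogonality of `Ψ` to
`a†(f_1) ⋯ a†(f_n) Ω` in the indefinite inner product means that the vacuum component of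
`a(f_n) ⋯ a(f_1) Ψ` vanishes. -/
def spuriousFock (s : ℕ) (b : ℝ) : Set (FiniteParticle s b) :=
  {Ψ | Ψ ∈ physicalFock s b ∧ ∀ l : List (OneStringPos s b), (∀ f ∈ l, f ∈ physicalPos s b) →
    SymmetricAlgebra.algebraMapInv (M := OneStringPos s b)
      (l.foldl (fun Ξ f => annihilate (s := s) (b := b) f Ξ) Ψ) = 0}

/-- `Φ` induces an operator on the physical space `𝓚' / 𝓚''`, and this operator is not zero. -/
def InducesObservable {s : ℕ} {b : ℝ} (Φ : Module.End ℂ (FiniteParticle s b)) : Prop :=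
  (∀ Ψ ∈ physicalFock s b, Φ Ψ ∈ physicalFock s b) ∧
    (∀ Ψ ∈ spuriousFock s b, Φ Ψ ∈ spuriousFock s b) ∧
      ∃ Ψ ∈ physicalFock s b, Φ Ψ ∉ spuriousFock s b

end StringField

end

/-! At each momentum p, the vector used is a DDF state (one transversal excitation built from
light-like oscillators), scaled so that it is polynomial in p. Choose real vectors k, t with k·k =
k·t = 0 and t·t = 1. Put κ = k·p and e = κ t - (t·p) k, so that e·k = e·p = 0 and e·e = κ². At level
n > 0 the vector χ(p) is the coefficient of z^n in (∑ κ^i e·α_{-(i+1)} z^(i+1)) exp(-n ∑ κ^i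
k·α_{-(i+1)} z^(i+1)/(i+1)). At level 0 it is Ω.

In L_m χ, m > 0, products of two annihilators vanish, because e occurs linearly and k·k = k·e = 0.
With v the coefficient of z^(n-m), the zero mode contributes -n κ^m v. By the product rule for z
d/dz (`sum_polCoeff_weighted`) the remaining terms contribute n κ^m v, so L_m χ = 0
(`virasoro_polVec`). No mass-shell condition and no particular value of b or d enters, since L_0 is
not involved. The indefinite norm of χ is n κ^(2n) for n > 0 (`form_polVec_self`,
`form_transversal_self`), hence nonnegative everywhere and positive where k·p ≠ 0.

Polynomial dependence on p gives compact support: multiplying a Fourier transform by a polynomial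
amounts to applying a differential operator to the test function (`exists_hat_eq_eval_mul`,
`exists_algebraicTest`). Take a radial bump f of small support whose transform has no zero in a ball
that meets the mass shell (`exists_bump`), and F with F̂ = f̂ χ. Since χ has sharp level, ψ = ΠF has
a single mass component, and ⟨ψ, ψ⟩ = 2π ∫ |f̂|² ⟨χ, χ⟩ dμ is positive.

For reality, the conjugation turns χ into the vector χ' built from the space reflections of k and t.
Both χ + χ' and i(χ - χ') are real and physical, and since ψ is half the sum of the vectors of χ +
χ' and χ - χ', at least one of the two real choices is not orthogonal to ψ
(`exists_krein_symmetrized_ne_zero`). A physical one-string vector that is not orthogonal to some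
physical vector is not spurious, and its field maps the vacuum to a non-spurious vector
(`inducesObservable_stringField`). The Poincaré statement holds because u(Λ) acts on 𝓕₀ and a test
function in 𝓢 ⊗ 𝓕₀ is a finite sum of products. -/

noncomputable section

namespace StringField

section

/-! ### The string field on the symmetric algebra -/

section Contract

variable {V : Type} [AddCommGroup V] [Module ℂ V]

/-- The algebra map to dual numbers whose `ε`-component is `contract φ`. -/
def contractLift (φ : V →ₗ[ℂ] ℂ) :
    SymmetricAlgebra ℂ V →ₐ[ℂ] DualNumber (SymmetricAlgebra ℂ V) :=
  SymmetricAlgebra.lift (A := DualNumber (SymmetricAlgebra ℂ V))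
    ((TrivSqZeroExt.inlAlgHom ℂ (SymmetricAlgebra ℂ V) (SymmetricAlgebra ℂ V)).toLinearMap ∘ₗ
        SymmetricAlgebra.ι ℂ V +
      ((TrivSqZeroExt.inrHom (SymmetricAlgebra ℂ V) (SymmetricAlgebra ℂ V)).restrictScalars ℂ) ∘ₗ
        Algebra.linearMap ℂ (SymmetricAlgebra ℂ V) ∘ₗ φ)

theorem contract_apply (φ : V →ₗ[ℂ] ℂ) (x : SymmetricAlgebra ℂ V) :
    contract φ x = (contractLift φ x).snd := rfl

theorem contractLift_ι (φ : V →ₗ[ℂ] ℂ) (g : V) :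
    contractLift φ (SymmetricAlgebra.ι ℂ V g) =
      TrivSqZeroExt.inl (SymmetricAlgebra.ι ℂ V g) +
        TrivSqZeroExt.inr (algebraMap ℂ (SymmetricAlgebra ℂ V) (φ g)) := by
  unfold contractLift
  rw [SymmetricAlgebra.lift_ι_apply]
  rfl

/-- This is what makes the ε-component obey the plain Leibniz rule in `contract_mul`. -/
theorem fst_contractLift (φ : V →ₗ[ℂ] ℂ) (x : SymmetricAlgebra ℂ V) :
    (contractLift φ x).fst = x := by
  have h : (TrivSqZeroExt.fstHom ℂ (SymmetricAlgebra ℂ V) (SymmetricAlgebra ℂ V)).comp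
      (contractLift φ) = AlgHom.id ℂ _ := by
    refine SymmetricAlgebra.algHom_ext (LinearMap.ext fun g => ?_)
    change (contractLift φ (SymmetricAlgebra.ι ℂ V g)).fst = SymmetricAlgebra.ι ℂ V g
    simp [contractLift_ι]
  exact congrArg (fun f : SymmetricAlgebra ℂ V →ₐ[ℂ] SymmetricAlgebra ℂ V => f x) h

theorem contract_ι (φ : V →ₗ[ℂ] ℂ) (g : V) :
    contract φ (SymmetricAlgebra.ι ℂ V g) = algebraMap ℂ _ (φ g) := by
  simp [contract_apply, contractLift_ι, Algebra.algebraMap_eq_smul_one]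

theorem contract_mul (φ : V →ₗ[ℂ] ℂ) (x y : SymmetricAlgebra ℂ V) :
    contract φ (x * y) = x * contract φ y + y * contract φ x := by
  simp only [contract_apply, map_mul, TrivSqZeroExt.snd_mul, fst_contractLift, smul_eq_mul,
    MulOpposite.smul_eq_mul_unop, MulOpposite.unop_op]
  ring

theorem contract_algebraMap (φ : V →ₗ[ℂ] ℂ) (c : ℂ) :
    contract φ (algebraMap ℂ (SymmetricAlgebra ℂ V) c) = 0 := by
  rw [contract_apply, AlgHom.commutes]
  rfl

/-- A derivation that sends generators to scalars preserves every subalgebra generated by vectors; φ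
may be arbitrary. -/
theorem contract_mem_adjoin (φ : V →ₗ[ℂ] ℂ) (P : Set V) {Ψ : SymmetricAlgebra ℂ V}
    (hΨ : Ψ ∈ Algebra.adjoin ℂ (SymmetricAlgebra.ι ℂ V '' P)) :
    contract φ Ψ ∈ Algebra.adjoin ℂ (SymmetricAlgebra.ι ℂ V '' P) := by
  induction hΨ using Algebra.adjoin_induction with
  | mem x hx =>
    obtain ⟨g, -, rfl⟩ := hx
    rw [contract_ι]
    exact Subalgebra.algebraMap_mem _ _
  | algebraMap c =>
    rw [contract_algebraMap]
    exact zero_mem _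
  | add x y _ _ hx hy =>
    rw [map_add]
    exact add_mem hx hy
  | mul x y hx' hy' hx hy =>
    rw [contract_mul]
    exact add_mem (mul_mem hx' hy) (mul_mem hy' hx)

/-- The field `(a†(f) + a(f)) / √2` for a vector `f`, where `B` is the form on `V`. -/
def fieldOp (B : V → V →ₗ[ℂ] ℂ) (f : V) : Module.End ℂ (SymmetricAlgebra ℂ V) :=
  ((1 / Real.sqrt 2 : ℝ) : ℂ) •
    (LinearMap.mulLeft ℂ (SymmetricAlgebra.ι ℂ V f) + contract (B f))

theorem fieldOp_apply (B : V → V →ₗ[ℂ] ℂ) (f : V) (Ψ : SymmetricAlgebra ℂ V) :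
    fieldOp B f Ψ = ((1 / Real.sqrt 2 : ℝ) : ℂ) •
      (SymmetricAlgebra.ι ℂ V f * Ψ + contract (B f) Ψ) := rfl

theorem fieldOp_mem_adjoin (B : V → V →ₗ[ℂ] ℂ) (P : Set V) {f : V} (hf : f ∈ P)
    {Ψ : SymmetricAlgebra ℂ V} (hΨ : Ψ ∈ Algebra.adjoin ℂ (SymmetricAlgebra.ι ℂ V '' P)) :
    fieldOp B f Ψ ∈ Algebra.adjoin ℂ (SymmetricAlgebra.ι ℂ V '' P) :=
  Subalgebra.smul_mem _ (add_mem (mul_mem (Algebra.subset_adjoin (Set.mem_image_of_mem _ hf)) hΨ)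
    (contract_mem_adjoin _ P hΨ)) _

/-- The vacuum component of `a(f_n) ⋯ a(f_1) Ψ`. -/
def vacuumComponent (B : V → V →ₗ[ℂ] ℂ) (l : List V) (Ψ : SymmetricAlgebra ℂ V) : ℂ :=
  SymmetricAlgebra.algebraMapInv (M := V) (l.foldl (fun Ξ f => contract (B f) Ξ) Ψ)

theorem vacuumComponent_nil (B : V → V →ₗ[ℂ] ℂ) (Ψ : SymmetricAlgebra ℂ V) :
    vacuumComponent B [] Ψ = SymmetricAlgebra.algebraMapInv (M := V) Ψ := rfl

theorem vacuumComponent_cons (B : V → V →ₗ[ℂ] ℂ) (f : V) (l : List V)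
    (Ψ : SymmetricAlgebra ℂ V) :
    vacuumComponent B (f :: l) Ψ = vacuumComponent B l (contract (B f) Ψ) := rfl

theorem vacuumComponent_add (B : V → V →ₗ[ℂ] ℂ) (l : List V) (Ψ Ξ : SymmetricAlgebra ℂ V) :
    vacuumComponent B l (Ψ + Ξ) = vacuumComponent B l Ψ + vacuumComponent B l Ξ := by
  induction l generalizing Ψ Ξ with
  | nil => simp only [vacuumComponent_nil, map_add]
  | cons f l ih => simp only [vacuumComponent_cons, map_add, ih]

theorem vacuumComponent_smul (B : V → V →ₗ[ℂ] ℂ) (l : List V) (c : ℂ)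
    (Ψ : SymmetricAlgebra ℂ V) : vacuumComponent B l (c • Ψ) = c * vacuumComponent B l Ψ := by
  induction l generalizing Ψ with
  | nil => simp only [vacuumComponent_nil, map_smul, smul_eq_mul]
  | cons f l ih => simp only [vacuumComponent_cons, map_smul, ih]

theorem algebraMapInv_ι (g : V) :
    SymmetricAlgebra.algebraMapInv (M := V) (SymmetricAlgebra.ι ℂ V g) = 0 := by
  simp [SymmetricAlgebra.algebraMapInv]

theorem contract_ι_mul (φ : V →ₗ[ℂ] ℂ) (g : V) (Ψ : SymmetricAlgebra ℂ V) :
    contract φ (SymmetricAlgebra.ι ℂ V g * Ψ) =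
      SymmetricAlgebra.ι ℂ V g * contract φ Ψ + φ g • Ψ := by
  rw [contract_mul, contract_ι, Algebra.smul_def, mul_comm Ψ]

/-- Commuting a†(g) past the annihilators produces matrix elements of Ψ with fewer annihilators,
which vanish by hypothesis. What is left has a†(g) as a factor and so no vacuum component. -/
theorem vacuumComponent_ι_mul_eq_zero (B : V → V →ₗ[ℂ] ℂ) (P : Set V) (g : V) (l : List V)
    (hl : ∀ f ∈ l, f ∈ P) (Ψ : SymmetricAlgebra ℂ V)
    (hΨ : ∀ l' : List V, (∀ f ∈ l', f ∈ P) → vacuumComponent B l' Ψ = 0) :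
    vacuumComponent B l (SymmetricAlgebra.ι ℂ V g * Ψ) = 0 := by
  induction l generalizing Ψ with
  | nil => rw [vacuumComponent_nil, map_mul, algebraMapInv_ι, zero_mul]
  | cons f l ih =>
    have hl' : ∀ f ∈ l, f ∈ P := fun f' hf' => hl f' (List.mem_cons_of_mem _ hf')
    rw [vacuumComponent_cons, contract_ι_mul, vacuumComponent_add, vacuumComponent_smul,
      hΨ l hl', mul_zero, add_zero]
    refine ih hl' _ fun l' h' => hΨ (f :: l') ?_
    exact List.forall_mem_cons.mpr ⟨hl f List.mem_cons_self, h'⟩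

/-- The annihilation part only prepends f to the list of annihilators, which is allowed because f
lies in P. -/
theorem vacuumComponent_fieldOp_eq_zero (B : V → V →ₗ[ℂ] ℂ) (P : Set V) {f : V} (hf : f ∈ P)
    (Ψ : SymmetricAlgebra ℂ V)
    (hΨ : ∀ l : List V, (∀ g ∈ l, g ∈ P) → vacuumComponent B l Ψ = 0)
    (l : List V) (hl : ∀ g ∈ l, g ∈ P) : vacuumComponent B l (fieldOp B f Ψ) = 0 := by
  rw [fieldOp_apply, vacuumComponent_smul, vacuumComponent_add,
    vacuumComponent_ι_mul_eq_zero B P f l hl Ψ hΨ, ← vacuumComponent_cons,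
    hΨ _ (List.forall_mem_cons.mpr ⟨hf, hl⟩), add_zero, mul_zero]

theorem vacuumComponent_fieldOp_one (B : V → V →ₗ[ℂ] ℂ) (f g : V) :
    vacuumComponent B [g] (fieldOp B f 1) = ((1 / Real.sqrt 2 : ℝ) : ℂ) * B g f := by
  have h (φ : V →ₗ[ℂ] ℂ) : contract φ (1 : SymmetricAlgebra ℂ V) = 0 := by
    simpa using contract_algebraMap φ 1
  rw [fieldOp_apply, h, add_zero, vacuumComponent_smul, vacuumComponent_cons, contract_ι_mul, h,
    mul_zero, zero_add, vacuumComponent_smul, vacuumComponent_nil, map_one, mul_one]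

end Contract

/-- The vacuum witnesses nontriviality: its image is the one-string vector f/√2, which pairs with g
to ⟨g, f⟩/√2. -/
theorem inducesObservable_stringField {s : ℕ} {b : ℝ} {f g : OneStringPos s b}
    (hf : f ∈ physicalPos s b) (hg : g ∈ physicalPos s b)
    (h : krein (g : OneString s b) f ≠ 0) : InducesObservable (stringField f) := by
  refine ⟨fun Ψ hΨ => fieldOp_mem_adjoin kreinFunctional (physicalPos s b) hf hΨ,
    fun Ψ hΨ => ⟨fieldOp_mem_adjoin kreinFunctional (physicalPos s b) hf hΨ.1,
      vacuumComponent_fieldOp_eq_zero kreinFunctional (physicalPos s b) hf Ψ hΨ.2⟩,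
    1, Subalgebra.one_mem _, fun hmem => ?_⟩
  have h1 : vacuumComponent kreinFunctional [g] (fieldOp kreinFunctional f 1) = 0 :=
    hmem.2 [g] (List.forall_mem_singleton.mpr hg)
  rw [vacuumComponent_fieldOp_one] at h1
  rcases mul_eq_zero.mp h1 with h2 | h2
  · simp at h2
  · exact h h2

end

section

/-! ### Algebraic test functions and Poincaré transforms -/

variable {s : ℕ}

theorem embed_apply (χ : Fock₀ s) (k : Mode s →₀ ℕ) :
    embed χ k = (Real.sqrt (occNormSq k) : ℂ) * χ.coeff k := rfl

theorem occNormSq_pos (k : Mode s →₀ ℕ) : 0 < occNormSq k := by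
  unfold occNormSq Finsupp.prod
  refine Finset.prod_pos fun i _ => ?_
  have : (0 : ℝ) < ((i.1 : ℕ) : ℝ) := by exact_mod_cast i.1.pos
  positivity

theorem embed_injective : Function.Injective (embed : Fock₀ s → FockSpace s) := by
  intro χ ξ h
  ext k
  have h1 : embed χ k = embed ξ k := by rw [h]
  rw [embed_apply, embed_apply] at h1
  refine mul_left_cancel₀ ?_ h1
  simpa using (Real.sqrt_pos.mpr (occNormSq_pos k)).ne'

/-- The test function `x ↦ f(x) v`. -/
def tensorVec (f : 𝓢(Spacetime s, ℂ)) (v : FockSpace s) : 𝓢(Spacetime s, FockSpace s) :=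
  SchwartzMap.postcompCLM (ContinuousLinearMap.toSpanSingleton ℂ v) f

theorem tensorVec_apply (f : 𝓢(Spacetime s, ℂ)) (v : FockSpace s) (x : Spacetime s) :
    tensorVec f v x = f x • v := rfl

/-- The test function `∑ f_i ⊗ χ_i`. -/
def algebraicTest {ι : Type*} [Fintype ι] (f : ι → 𝓢(Spacetime s, ℂ)) (χ : ι → Fock₀ s) :
    𝓢(Spacetime s, FockSpace s) := ∑ i, tensorVec (f i) (embed (χ i))

theorem algebraicTest_apply {ι : Type*} [Fintype ι] (f : ι → 𝓢(Spacetime s, ℂ))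
    (χ : ι → Fock₀ s) (x : Spacetime s) :
    algebraicTest f χ x = ∑ i, f i x • embed (χ i) := by
  simp [algebraicTest, tensorVec_apply]

theorem algebraicTest_apply_eq_embed {ι : Type*} [Fintype ι] (f : ι → 𝓢(Spacetime s, ℂ))
    (χ : ι → Fock₀ s) (x : Spacetime s) :
    algebraicTest f χ x = embed (∑ i, f i x • χ i) := by
  simp [algebraicTest_apply]

theorem isAlgebraic_algebraicTest {ι : Type*} [Fintype ι] (f : ι → 𝓢(Spacetime s, ℂ))
    (χ : ι → Fock₀ s) : IsAlgebraic (algebraicTest f χ) := by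
  refine ⟨Fintype.card ι, f ∘ (Fintype.equivFin ι).symm, χ ∘ (Fintype.equivFin ι).symm,
    fun x => ?_⟩
  rw [algebraicTest_apply]
  exact (Equiv.sum_comp (Fintype.equivFin ι).symm fun i => f i x • embed (χ i)).symm

/-! ### Lorentz matrices and affine substitutions. -/

theorem IsLorentz.isUnit_det {Λ : Matrix (Fin (s + 1)) (Fin (s + 1)) ℝ} (h : IsLorentz Λ) :
    IsUnit Λ.det := by
  have h1 : Λ.transpose.det * (Matrix.diagonal (eta (s := s))).det * Λ.det =
      (Matrix.diagonal (eta (s := s))).det := by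
    rw [← Matrix.det_mul, ← Matrix.det_mul]
    exact congrArg _ h
  have h2 : (Matrix.diagonal (eta (s := s))).det ≠ 0 := by
    rw [Matrix.det_diagonal]
    refine Finset.prod_ne_zero_iff.mpr fun i _ => ?_
    unfold eta
    split_ifs <;> norm_num
  rw [isUnit_iff_ne_zero]
  rintro h0
  rw [h0, mul_zero] at h1
  exact h2 h1.symm

/-- Serves both for Poincaré transforms and for the rescaling of frequencies that relates the
Euclidean Fourier transform to the Minkowski one. -/
theorem exists_schwartz_comp {M : Matrix (Fin (s + 1)) (Fin (s + 1)) ℝ} (h : IsUnit M.det)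
    (a : Spacetime s) (f : 𝓢(Spacetime s, ℂ)) :
    ∃ g : 𝓢(Spacetime s, ℂ), ∀ x, g x = f (Matrix.toEuclideanLin M (x - a)) := by
  have hinj : LinearMap.ker (Matrix.toEuclideanLin (𝕜 := ℝ) M) = ⊥ := by
    rw [LinearMap.ker_eq_bot']
    intro x hx
    have h1 : M⁻¹.mulVec (M.mulVec x.ofLp) = 0 := by
      have h2 : M.mulVec x.ofLp = 0 := congrArg WithLp.ofLp hx
      rw [h2, Matrix.mulVec_zero]
    rw [Matrix.mulVec_mulVec, Matrix.nonsing_inv_mul _ h, Matrix.one_mulVec] at h1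
    exact (WithLp.ofLp_eq_zero 2).mp h1
  let e : Spacetime s ≃L[ℝ] Spacetime s :=
    (LinearEquiv.ofInjectiveEndo _ (LinearMap.ker_eq_bot.mp hinj)).toContinuousLinearEquiv
  exact ⟨SchwartzMap.compSubConstCLM ℂ a (SchwartzMap.compCLMOfContinuousLinearEquiv ℂ e f),
    fun x => rfl⟩

/-- Since `embed` is injective, each value of F has only one preimage in 𝓕₀, so the values of the
transform are forced. Existence is checked factor by factor on the finite sum. -/
theorem existsUnique_poincareTransform (F : 𝓢(Spacetime s, FockSpace s)) (hF : IsAlgebraic F)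
    (a : Spacetime s) (Λ : Matrix (Fin (s + 1)) (Fin (s + 1)) ℝ) (hΛ : IsLorentz Λ) :
    ∃! G : 𝓢(Spacetime s, FockSpace s), IsAlgebraic G ∧ IsPoincareTransform a Λ F G := by
  obtain ⟨k, f, χ, hf⟩ := hF
  choose g hg using fun i => exists_schwartz_comp
    (Matrix.isUnit_nonsing_inv_det _ hΛ.isUnit_det) a (f i)
  refine ⟨algebraicTest g fun i => lorentzRep Λ (χ i), ⟨isAlgebraic_algebraicTest _ _, fun x => ?_⟩,
    fun G hG => ?_⟩
  · refine ⟨∑ i, g i x • χ i, ?_, ?_⟩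
    · simp [hf, hg]
    · simp [algebraicTest_apply_eq_embed]
  · ext1 x
    obtain ⟨ξ, h1, h2⟩ := hG.2 x
    have h3 : ξ = ∑ i, g i x • χ i := embed_injective (by rw [← h1, hf]; simp [hg])
    rw [h2, h3, algebraicTest_apply_eq_embed]
    simp

end

section

/-! ### The recursion for exponentials of light-like oscillators -/

section Recursion

variable {A : Type*} [CommRing A] [Algebra ℚ A]

/-- The coefficients of `exp (-n ∑ i, κ ^ i * w i * z ^ (i + 1) / (i + 1))`. -/
def expCoeffNat (n : ℕ) (κ : A) (w : ℕ → A) : ℕ → A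
  | 0 => 1
  | l + 1 => algebraMap ℚ A ((l : ℚ) + 1)⁻¹ *
      ∑ i : Fin (l + 1), -(n : A) * κ ^ (i : ℕ) * w i * expCoeffNat n κ w (l - i)

/-- `expCoeffNat`, extended by zero to negative indices. -/
def expCoeff (n : ℕ) (κ : A) (w : ℕ → A) (l : ℤ) : A :=
  if l < 0 then 0 else expCoeffNat n κ w l.toNat

/-- The coefficients of the product of `∑ i, κ ^ i * E i * z ^ (i + 1)` with the series of
`expCoeff`. -/
def polCoeff (n : ℕ) (κ : A) (w E : ℕ → A) (l : ℤ) : A :=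
  ∑ j ∈ Finset.range l.toNat, κ ^ j * E j * expCoeff n κ w (l - 1 - j)

variable (n : ℕ) (κ : A) (w E : ℕ → A)

theorem expCoeff_of_neg {l : ℤ} (h : l < 0) : expCoeff n κ w l = 0 := if_pos h

theorem expCoeff_zero : expCoeff n κ w 0 = 1 := by
  simp [expCoeff, expCoeffNat]

/-- This is z d/dz applied to the exponential. Because coefficients of negative degree are zero, it
holds for every integer l, and the convolution may be cut off at any L ≥ l. -/
theorem mul_expCoeff (l : ℤ) (L : ℕ) (hL : l ≤ L) :
    (l : A) * expCoeff n κ w l =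
      ∑ i ∈ Finset.range L, -(n : A) * κ ^ i * w i * expCoeff n κ w (l - 1 - i) := by
  rcases lt_trichotomy l 0 with h | rfl | h
  · rw [expCoeff_of_neg n κ w h, mul_zero]
    refine (Finset.sum_eq_zero fun i _ => ?_).symm
    rw [expCoeff_of_neg n κ w (by omega), mul_zero]
  · rw [Int.cast_zero, zero_mul]
    refine (Finset.sum_eq_zero fun i _ => ?_).symm
    rw [expCoeff_of_neg n κ w (by omega), mul_zero]
  · obtain ⟨m, rfl⟩ : ∃ m : ℕ, l = (m + 1 : ℕ) := ⟨l.toNat - 1, by omega⟩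
    have h1 : expCoeff n κ w (m + 1 : ℕ) = expCoeffNat n κ w (m + 1) := by
      rw [expCoeff, if_neg (by omega), Int.toNat_natCast]
    have h2 : (((m + 1 : ℕ) : ℤ) : A) * algebraMap ℚ A ((m : ℚ) + 1)⁻¹ = 1 := by
      have : (((m + 1 : ℕ) : ℤ) : A) = algebraMap ℚ A ((m : ℚ) + 1) := by simp
      rw [this, ← map_mul, mul_inv_cancel₀ (by positivity), map_one]
    rw [h1, expCoeffNat, ← mul_assoc, h2, one_mul,
      Fin.sum_univ_eq_sum_range
        (fun i => -(n : A) * κ ^ i * w i * expCoeffNat n κ w (m - i)) (m + 1)]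
    have h3 : m + 1 ≤ L := by omega
    rw [← Finset.sum_subset (Finset.range_subset_range.mpr h3)]
    · refine Finset.sum_congr rfl fun i hi => ?_
      rw [Finset.mem_range] at hi
      rw [expCoeff, if_neg (by omega)]
      congr 2
      omega
    · intro i _ hi
      rw [Finset.mem_range] at hi
      rw [expCoeff_of_neg n κ w (by omega), mul_zero]

theorem polCoeff_eq_sum (l : ℤ) (L : ℕ) (hL : l ≤ L) :
    polCoeff n κ w E l = ∑ j ∈ Finset.range L, κ ^ j * E j * expCoeff n κ w (l - 1 - j) := by
  refine Finset.sum_subset (Finset.range_subset_range.mpr (by omega)) ?_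
  intro i _ hi
  rw [Finset.mem_range] at hi
  rw [expCoeff_of_neg n κ w (by omega), mul_zero]

theorem polCoeff_of_nonpos {l : ℤ} (h : l ≤ 0) : polCoeff n κ w E l = 0 := by
  rw [polCoeff_eq_sum n κ w E l 0 (by simpa using h), Finset.sum_range_zero]

/-- Associativity of the convolution: the logarithmic derivative of the exponential times (E · exp)
equals E times z d/dz exp. -/
theorem sum_mul_polCoeff (l : ℤ) (L : ℕ) (hL : l ≤ L) :
    ∑ i ∈ Finset.range L, -(n : A) * κ ^ i * w i * polCoeff n κ w E (l - 1 - i) =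
      ∑ j ∈ Finset.range L, κ ^ j * E j * (((l - 1 - j : ℤ) : A) *
        expCoeff n κ w (l - 1 - j)) := by
  have h1 (i : ℕ) : polCoeff n κ w E (l - 1 - i) =
      ∑ j ∈ Finset.range L, κ ^ j * E j * expCoeff n κ w (l - 1 - i - 1 - j) :=
    polCoeff_eq_sum n κ w E _ L (by omega)
  have h2 (j : ℕ) : ((l - 1 - j : ℤ) : A) * expCoeff n κ w (l - 1 - j) =
      ∑ i ∈ Finset.range L, -(n : A) * κ ^ i * w i * expCoeff n κ w (l - 1 - j - 1 - i) :=
    mul_expCoeff n κ w _ L (by omega)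
  simp only [h1, h2, Finset.mul_sum]
  rw [Finset.sum_comm]
  refine Finset.sum_congr rfl fun j _ => Finset.sum_congr rfl fun i _ => ?_
  rw [show l - 1 - (i : ℤ) - 1 - j = l - 1 - j - 1 - i by ring]
  ring

/-- Product rule for z d/dz on (∑ κ^i E_i z^(i+1)) · exp, plus m times that product. The case m = 0
yields the eigenvalue of N, and m > 0 the oscillator part of L_m. -/
theorem sum_polCoeff_weighted (m : A) (l : ℤ) (L : ℕ) (hL : l ≤ L) :
    ∑ i ∈ Finset.range L, κ ^ i * ((m + i + 1) * (E i * expCoeff n κ w (l - 1 - i)) -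
      n * (w i * polCoeff n κ w E (l - 1 - i))) = (m + l) * polCoeff n κ w E l := by
  have h := sum_mul_polCoeff n κ w E l L hL
  calc _ = ∑ i ∈ Finset.range L, κ ^ i * ((m + i + 1) * (E i * expCoeff n κ w (l - 1 - i))) +
        ∑ i ∈ Finset.range L, -(n : A) * κ ^ i * w i * polCoeff n κ w E (l - 1 - i) := by
        rw [← Finset.sum_add_distrib]
        exact Finset.sum_congr rfl fun i _ => by ring
    _ = _ := by
        rw [h, polCoeff_eq_sum n κ w E l L hL, ← Finset.sum_add_distrib, Finset.mul_sum]
        refine Finset.sum_congr rfl fun i _ => ?_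
        push_cast
        ring

theorem map_expCoeffNat {B : Type*} [CommRing B] [Algebra ℚ B] (f : A →+* B) (l : ℕ) :
    f (expCoeffNat n κ w l) = expCoeffNat n (f κ) (fun i => f (w i)) l := by
  induction l using Nat.strong_induction_on with
  | _ l ih =>
    cases l with
    | zero => simp [expCoeffNat]
    | succ l =>
      rw [expCoeffNat, expCoeffNat, map_mul, map_sum, RingHom.map_rat_algebraMap]
      congr 1
      refine Finset.sum_congr rfl fun i _ => ?_
      rw [map_mul, map_mul, map_mul, map_neg, map_natCast, map_pow, ih _ (by omega)]

theorem map_expCoeff {B : Type*} [CommRing B] [Algebra ℚ B] (f : A →+* B) (l : ℤ) :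
    f (expCoeff n κ w l) = expCoeff n (f κ) (fun i => f (w i)) l := by
  unfold expCoeff
  split_ifs
  · exact map_zero f
  · exact map_expCoeffNat n κ w f _

/-- Needed for mere ring homomorphisms: evaluation at a momentum, and the antilinear `conjVec`. -/
theorem map_polCoeff {B : Type*} [CommRing B] [Algebra ℚ B] (f : A →+* B) (l : ℤ) :
    f (polCoeff n κ w E l) = polCoeff n (f κ) (fun i => f (w i)) (fun i => f (E i)) l := by
  simp [polCoeff, map_sum, map_expCoeff]

/-! ### Derivations acting on the coefficients. -/

variable [IsDomain A] {R : Type*} [CommRing R] [Algebra R A] (D : Derivation R A A)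

/-- Chain rule: D exp(…) = -n κ^a c z^(a+1)/(a+1) · exp(…), proved on coefficients by strong
induction through the recursion. -/
theorem derivation_expCoeff (hκ : D κ = 0) (a : ℕ) (c : A)
    (hw : ∀ i, D (w i) = if i = a then c else 0) (l : ℤ) :
    ((a : A) + 1) * D (expCoeff n κ w l) =
      -(n : A) * κ ^ a * c * expCoeff n κ w (l - 1 - a) := by
  have : CharZero A := algebraRat.charZero A
  rcases lt_trichotomy l 0 with h | rfl | h
  · rw [expCoeff_of_neg n κ w h, expCoeff_of_neg n κ w (by omega), map_zero, mul_zero, mul_zero]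
  · rw [expCoeff_zero, expCoeff_of_neg n κ w (by omega), Derivation.map_one_eq_zero, mul_zero,
      mul_zero]
  · obtain ⟨m, rfl⟩ : ∃ m : ℕ, l = m := ⟨l.toNat, by omega⟩
    induction m using Nat.strong_induction_on with
    | _ m ih =>
    have ih' (i : ℕ) : ((a : A) + 1) * D (expCoeff n κ w (m - 1 - i : ℤ)) =
        -(n : A) * κ ^ a * c * expCoeff n κ w (m - 1 - i - 1 - a : ℤ) := by
      rcases lt_trichotomy (m - 1 - i : ℤ) 0 with h' | h' | h'
      · rw [expCoeff_of_neg n κ w h', expCoeff_of_neg n κ w (by omega), map_zero, mul_zero,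
          mul_zero]
      · rw [h', expCoeff_zero, expCoeff_of_neg n κ w (by omega), Derivation.map_one_eq_zero,
          mul_zero, mul_zero]
      · obtain ⟨m', hm'⟩ : ∃ m' : ℕ, (m - 1 - i : ℤ) = m' := ⟨(m - 1 - i : ℤ).toNat, by omega⟩
        rw [hm']
        exact ih m' (by omega) (by omega)
    have h0 : ((m : ℤ) : A) ≠ 0 := by
      rw [Int.cast_natCast, Nat.cast_ne_zero]
      omega
    -- After multiplication by the degree m, the recursion can be differentiated and the induction
    -- hypothesis applied inside its sum.
    refine mul_left_cancel₀ h0 ?_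
    have h1 := congrArg D (mul_expCoeff n κ w m (m + a + 1) (by omega))
    have hm0 : D ((m : ℤ) : A) = 0 := by
      rw [Int.cast_natCast]
      exact D.map_natCast m
    have hn0 : D (-(n : A)) = 0 := by
      rw [map_neg, D.map_natCast, neg_zero]
    have hc (i : ℕ) : D (-(n : A) * κ ^ i) = 0 := by
      rw [Derivation.leibniz, Derivation.leibniz_pow, hκ, hn0]
      simp
    rw [Derivation.leibniz, hm0, smul_zero, add_zero, smul_eq_mul, map_sum] at h1
    calc ((m : ℤ) : A) * (((a : A) + 1) * D (expCoeff n κ w m))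
        = ((a : A) + 1) * (((m : ℤ) : A) * D (expCoeff n κ w m)) := by ring
      _ = ∑ i ∈ Finset.range (m + a + 1), (-(n : A) * κ ^ i * (if i = a then c else 0) *
              (((a : A) + 1) * expCoeff n κ w (m - 1 - i : ℤ)) +
            -(n : A) * κ ^ a * c * (-(n : A) * κ ^ i * w i *
              expCoeff n κ w (m - 1 - a - 1 - i : ℤ))) := by
          rw [h1, Finset.mul_sum]
          refine Finset.sum_congr rfl fun i _ => ?_
          rw [Derivation.leibniz, Derivation.leibniz, hc, hw, smul_eq_mul, smul_eq_mul,
            smul_eq_mul, smul_zero, add_zero, mul_add, ← mul_assoc ((a : A) + 1),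
            mul_comm ((a : A) + 1), mul_assoc _ ((a : A) + 1), ih' i,
            show (m - 1 - i - 1 - a : ℤ) = m - 1 - a - 1 - i by ring]
          ring
      _ = _ := by
          rw [Finset.sum_add_distrib, ← Finset.mul_sum,
            ← mul_expCoeff n κ w (m - 1 - a) (m + a + 1) (by omega)]
          simp only [mul_ite, mul_zero, ite_mul, zero_mul]
          rw [Finset.sum_ite_eq' (Finset.range (m + a + 1)) a, if_pos (by simp)]
          push_cast
          ring

theorem derivation_polCoeff (hκ : D κ = 0) (a : ℕ) (c d : A)
    (hw : ∀ i, D (w i) = if i = a then c else 0)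
    (hE : ∀ i, D (E i) = if i = a then d else 0) (l : ℤ) :
    ((a : A) + 1) * D (polCoeff n κ w E l) =
      κ ^ a * (((a : A) + 1) * d * expCoeff n κ w (l - 1 - a) -
        n * c * polCoeff n κ w E (l - 1 - a)) := by
  have hc (i : ℕ) : D (κ ^ i) = 0 := by
    rw [Derivation.leibniz_pow, hκ]
    simp
  rw [polCoeff_eq_sum n κ w E l (l.toNat + a + 1) (by omega),
    polCoeff_eq_sum n κ w E (l - 1 - a) (l.toNat + a + 1) (by omega), map_sum, Finset.mul_sum]
  calc _ = ∑ i ∈ Finset.range (l.toNat + a + 1), (κ ^ i * (if i = a then d else 0) *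
              (((a : A) + 1) * expCoeff n κ w (l - 1 - i)) +
            -(n : A) * κ ^ a * c * (κ ^ i * E i * expCoeff n κ w (l - 1 - a - 1 - i))) := by
          refine Finset.sum_congr rfl fun i _ => ?_
          rw [Derivation.leibniz, Derivation.leibniz, hc, hE, smul_eq_mul, smul_eq_mul,
            smul_eq_mul, smul_zero, add_zero, mul_add, ← mul_assoc ((a : A) + 1),
            mul_comm ((a : A) + 1), mul_assoc _ ((a : A) + 1),
            derivation_expCoeff n κ w D hκ a c hw,
            show (l - 1 - i - 1 - a : ℤ) = l - 1 - a - 1 - i by ring]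
          ring
    _ = _ := by
          rw [Finset.sum_add_distrib, ← Finset.mul_sum]
          simp only [mul_ite, mul_zero, ite_mul, zero_mul]
          rw [Finset.sum_ite_eq' (Finset.range (l.toNat + a + 1)) a, if_pos (by simp)]
          ring

end Recursion

end

section

/-! ### Oscillators and constraint operators -/

variable {s : ℕ}

theorem eta_mul_self (μ : Fin (s + 1)) : eta μ * eta μ = 1 := by
  unfold eta
  split_ifs <;> norm_num

theorem alpha_zero (p : Spacetime s) (μ : Fin (s + 1)) (χ : Fock₀ s) :
    alpha p 0 μ χ = (p μ : ℂ) • χ := rfl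

theorem alpha_succ (p : Spacetime s) (a : ℕ) (μ : Fin (s + 1)) (χ : Fock₀ s) :
    alpha p ((a : ℤ) + 1) μ χ =
      (((a + 1 : ℕ) : ℂ) * (eta μ : ℂ)) • MvPolynomial.pderiv (a.succPNat, μ) χ := rfl

theorem alpha_neg_succ (p : Spacetime s) (a : ℕ) (μ : Fin (s + 1)) (χ : Fock₀ s) :
    alpha p (-((a : ℤ) + 1)) μ χ = MvPolynomial.X (a.succPNat, μ) * χ := by
  rw [← Int.negSucc_eq]
  rfl

theorem wick_comm (p : Spacetime s) (k l : ℤ) (μ : Fin (s + 1)) :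
    wick p k l μ = wick p l k μ := by
  unfold wick
  rcases lt_trichotomy k l with h | rfl | h
  · rw [if_pos h.le, if_neg (not_le.mpr h)]
  · rfl
  · rw [if_neg (not_le.mpr h), if_pos h.le]

/-- A finitely supported sum over the integers that is symmetric under `n ↦ m - n` and vanishes
for `0 < n < m`. -/
theorem finsum_int_symm {A : Type*} [AddCommGroup A] (W : ℤ → A) (m L : ℕ)
    (hsymm : ∀ n, W (m - n) = W n) (hzero : ∀ n : ℤ, 0 < n → n < m → W n = 0)
    (h0 : m = 0 → W 0 = 0) (hL : ∀ n : ℤ, (m : ℤ) + L ≤ n → W n = 0) :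
    ∑ᶠ n, W n = 2 • ∑ j ∈ Finset.range L, W (m + j) := by
  classical
  let V : ℤ → A := fun n => if (m : ℤ) ≤ n then W n else 0
  have hV : Function.support V ⊆
      ((Finset.range L).image fun j : ℕ => (m : ℤ) + j : Finset ℤ) := by
    intro n hn
    by_cases h : (m : ℤ) ≤ n
    · have h' : n < (m : ℤ) + L := by
        by_contra hcon
        exact hn (by simp only [V, if_pos h]; exact hL n (by omega))
      simp only [Finset.coe_image, Set.mem_image, Finset.mem_coe, Finset.mem_range]
      exact ⟨(n - m).toNat, by omega, by omega⟩
    · exact absurd (if_neg h) hn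
  have hsum : ∑ᶠ n, V n = ∑ j ∈ Finset.range L, W (m + j) := by
    rw [finsum_eq_sum_of_support_subset V hV, Finset.sum_image fun i _ j _ h => by simpa using h]
    refine Finset.sum_congr rfl fun j _ => ?_
    simp [V]
  have hfin : (Function.support V).Finite := (Finset.finite_toSet _).subset hV
  -- The reflection exchanges n ≥ m with n ≤ 0. When m = 0 the fixed point n = 0 is counted twice,
  -- which is harmless by `h0`.
  have hW : W = fun n => V n + V (m - n) := by
    funext n
    simp only [V, hsymm]
    split_ifs with h1 h2 h2
    · obtain rfl : m = 0 := by omega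
      obtain rfl : n = 0 := by omega
      simp [h0]
    · simp
    · simp
    · rw [hzero n (by omega) (by omega), add_zero]
  have hcomp : ∑ᶠ n, V (m - n) = ∑ᶠ n, V n := finsum_comp_equiv (Equiv.subLeft (m : ℤ))
  have hfin' : (Function.support fun n => V (m - n)).Finite := by
    have := hfin.preimage (f := fun n : ℤ => (m : ℤ) - n) (by
      intro a _ b _ h
      simpa using h)
    exact this
  rw [hW, finsum_add_distrib hfin hfin', hcomp, hsum, two_nsmul]
  simp only [hW]

/-- The symmetry n ↦ m - n cancels the factor ½ and leaves one term for each annihilator of index at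
least m. Hypothesis `h2` discards the products of two annihilators. The self-paired zero mode occurs
only for m = 0, where p = 0, as in the definition of N. -/
theorem wickSum_eq_sum (p : Spacetime s) (m L : ℕ) (χ : Fock₀ s)
    (h2 : ∀ n : ℤ, 0 < n → n < m →
      ∑ μ, (eta μ : ℂ) • alpha p (m - n) μ (alpha p n μ χ) = 0)
    (h0 : m = 0 → p = 0) (hL : ∀ n : ℤ, (m : ℤ) + L ≤ n → ∀ μ, alpha p n μ χ = 0) :
    wickSum p m χ = ∑ j ∈ Finset.range L, ∑ μ, (eta μ : ℂ) •
      alpha p (-(j : ℤ)) μ (alpha p (m + j) μ χ) := by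
  have hwick (n : ℤ) (μ : Fin (s + 1)) (hn : (m : ℤ) - n ≤ n) :
      wick p (m - n) n μ χ = alpha p (m - n) μ (alpha p n μ χ) := by
    rw [wick, if_pos hn, LinearMap.comp_apply]
  unfold wickSum
  rw [finsum_int_symm _ m L]
  · rw [two_nsmul, ← two_smul ℂ, smul_smul, one_div_mul_cancel two_ne_zero, one_smul]
    refine Finset.sum_congr rfl fun j _ => Finset.sum_congr rfl fun μ _ => ?_
    rw [hwick _ _ (by omega), show (m : ℤ) - (m + j) = -(j : ℤ) by ring]
  · intro n
    refine Finset.sum_congr rfl fun μ _ => ?_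
    rw [wick_comm, sub_sub_cancel]
  · intro n hn hnm
    rcases le_or_gt ((m : ℤ) - n) n with h | h
    · simp only [hwick n _ h]
      exact h2 n hn hnm
    · have := h2 (m - n) (by omega) (by omega)
      simpa [wick, not_le.mpr h] using this
  · rintro rfl
    refine Finset.sum_eq_zero fun μ _ => ?_
    rw [hwick 0 μ (by simp), h0 rfl, alpha_zero, PiLp.zero_apply, Complex.ofReal_zero, zero_smul,
      map_zero, smul_zero]
  · intro n hn
    refine Finset.sum_eq_zero fun μ _ => ?_
    rcases lt_or_ge n ((m : ℤ) - n) with h | h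
    · rw [wick, if_neg (not_le.mpr h), LinearMap.comp_apply]
      obtain ⟨rfl, hn0⟩ : m = 0 ∧ n < 0 := by omega
      omega
    · rw [hwick n μ h, hL n hn, map_zero, smul_zero]

/-- The combination `v · α_{-(i+1)}` of creation operators. -/
def osc (v : Spacetime s) (i : ℕ) : Fock₀ s :=
  ∑ μ, MvPolynomial.C ((eta μ * v μ : ℝ) : ℂ) * MvPolynomial.X (i.succPNat, μ)

theorem pderiv_osc (v : Spacetime s) (a : ℕ) (μ : Fin (s + 1)) (i : ℕ) :
    MvPolynomial.pderiv (a.succPNat, μ) (osc v i) =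
      if i = a then MvPolynomial.C ((eta μ * v μ : ℝ) : ℂ) else 0 := by
  classical
  unfold osc
  rw [map_sum]
  simp only [MvPolynomial.pderiv_C_mul, MvPolynomial.pderiv_X, Pi.single_apply, Prod.mk.injEq]
  by_cases h : i = a
  · subst h
    simp
  · have h' : ¬ (i.succPNat = a.succPNat) := fun h' => h (Nat.succPNat_injective h')
    simp [h, h']

/-- The coefficients of the exponential of the light-like oscillators `k · α_{-i}`. -/
def expVec (n : ℕ) (k : Spacetime s) (κ : ℝ) (l : ℤ) : Fock₀ s :=
  expCoeff n (MvPolynomial.C (κ : ℂ)) (osc k) l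

/-- The coefficients of the exponential of the light-like oscillators, multiplied by oscillators
with polarization `e`. -/
def polVec (n : ℕ) (k e : Spacetime s) (κ : ℝ) (l : ℤ) : Fock₀ s :=
  polCoeff n (MvPolynomial.C (κ : ℂ)) (osc k) (osc e) l

variable (n : ℕ) (k e : Spacetime s) (κ : ℝ)

/-- Coherent state property: an annihilator multiplies the exponential series by a scalar multiple
of z^(a+1). The metric signs in `alpha` and `osc` cancel. -/
theorem alpha_expVec (p : Spacetime s) (a : ℕ) (μ : Fin (s + 1)) (l : ℤ) :
    alpha p ((a : ℤ) + 1) μ (expVec n k κ l) =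
      ((-(n * κ ^ a * k μ) : ℝ) : ℂ) • expVec n k κ (l - 1 - a) := by
  have h := derivation_expCoeff n (MvPolynomial.C (κ : ℂ)) (osc k)
    (MvPolynomial.pderiv (a.succPNat, μ)) MvPolynomial.pderiv_C a _ (pderiv_osc k a μ) l
  have h1 : (((a + 1 : ℕ) : ℂ) * (eta μ : ℂ)) •
      MvPolynomial.pderiv (a.succPNat, μ) (expVec n k κ l) = (eta μ : ℂ) •
        (((a : Fock₀ s) + 1) * MvPolynomial.pderiv (a.succPNat, μ) (expVec n k κ l)) := by
    rw [mul_comm, mul_smul]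
    congr 1
    rw [MvPolynomial.smul_eq_C_mul]
    push_cast
    rw [map_add, map_natCast, map_one]
  rw [alpha_succ, h1]
  unfold expVec
  rw [h, MvPolynomial.smul_eq_C_mul, MvPolynomial.smul_eq_C_mul]
  have h2 : (MvPolynomial.C (eta μ : ℂ) * MvPolynomial.C (eta μ : ℂ) : Fock₀ s) = 1 := by
    rw [← map_mul, ← Complex.ofReal_mul, eta_mul_self, Complex.ofReal_one, map_one]
  push_cast
  simp only [map_mul, map_neg, map_pow, map_natCast]
  linear_combination (-(n : Fock₀ s) * MvPolynomial.C (κ : ℂ) ^ a * MvPolynomial.C (k μ : ℂ) *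
    expCoeff n (MvPolynomial.C (κ : ℂ)) (osc k) (l - 1 - a)) * h2

theorem alpha_polVec (p : Spacetime s) (a : ℕ) (μ : Fin (s + 1)) (l : ℤ) :
    alpha p ((a : ℤ) + 1) μ (polVec n k e κ l) =
      ((κ ^ a * (a + 1) * e μ : ℝ) : ℂ) • expVec n k κ (l - 1 - a) -
        ((κ ^ a * n * k μ : ℝ) : ℂ) • polVec n k e κ (l - 1 - a) := by
  have h := derivation_polCoeff n (MvPolynomial.C (κ : ℂ)) (osc k) (osc e)
    (MvPolynomial.pderiv (a.succPNat, μ)) MvPolynomial.pderiv_C a _ _ (pderiv_osc k a μ)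
    (pderiv_osc e a μ) l
  have h1 : (((a + 1 : ℕ) : ℂ) * (eta μ : ℂ)) •
      MvPolynomial.pderiv (a.succPNat, μ) (polVec n k e κ l) = (eta μ : ℂ) •
        (((a : Fock₀ s) + 1) * MvPolynomial.pderiv (a.succPNat, μ) (polVec n k e κ l)) := by
    rw [mul_comm, mul_smul]
    congr 1
    rw [MvPolynomial.smul_eq_C_mul]
    push_cast
    rw [map_add, map_natCast, map_one]
  rw [alpha_succ, h1]
  unfold polVec expVec
  rw [h, MvPolynomial.smul_eq_C_mul, MvPolynomial.smul_eq_C_mul, MvPolynomial.smul_eq_C_mul]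
  have h2 : (MvPolynomial.C (eta μ : ℂ) * MvPolynomial.C (eta μ : ℂ) : Fock₀ s) = 1 := by
    rw [← map_mul, ← Complex.ofReal_mul, eta_mul_self, Complex.ofReal_one, map_one]
  push_cast
  simp only [map_mul, map_pow, map_natCast, map_add, map_one]
  linear_combination (MvPolynomial.C (κ : ℂ) ^ a *
    (((a : Fock₀ s) + 1) * MvPolynomial.C (e μ : ℂ) *
      expCoeff n (MvPolynomial.C (κ : ℂ)) (osc k) (l - 1 - a) - n * MvPolynomial.C (k μ : ℂ) *
      polCoeff n (MvPolynomial.C (κ : ℂ)) (osc k) (osc e) (l - 1 - a))) * h2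

theorem alpha_polVec_eq_zero (p : Spacetime s) (l : ℕ) (m : ℤ) (hm : (l : ℤ) < m)
    (μ : Fin (s + 1)) : alpha p m μ (polVec n k e κ l) = 0 := by
  obtain ⟨a, rfl⟩ : ∃ a : ℕ, m = a + 1 := ⟨(m - 1).toNat, by omega⟩
  rw [alpha_polVec, expVec, expCoeff_of_neg _ _ _ (by omega), polVec,
    polCoeff_of_nonpos _ _ _ _ (by omega), smul_zero, smul_zero, sub_zero]

theorem sum_osc (v : Spacetime s) (i : ℕ) (c : ℝ) (χ : Fock₀ s) :
    ∑ μ, (eta μ : ℂ) • (MvPolynomial.X (i.succPNat, μ) * (((c * v μ : ℝ) : ℂ) • χ)) =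
      (c : ℂ) • (osc v i * χ) := by
  unfold osc
  rw [Finset.sum_mul, Finset.smul_sum]
  refine Finset.sum_congr rfl fun μ _ => ?_
  simp only [MvPolynomial.smul_eq_C_mul]
  push_cast
  simp only [map_mul]
  ring

theorem sum_smul_minkowski (v u : Spacetime s) (c : ℝ) (χ : Fock₀ s) :
    ∑ μ, (eta μ : ℂ) • ((u μ : ℂ) • (((c * v μ : ℝ) : ℂ) • χ)) =
      ((c * minkowski v u : ℝ) : ℂ) • χ := by
  unfold minkowski
  rw [Finset.mul_sum, Complex.ofReal_sum, Finset.sum_smul]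
  refine Finset.sum_congr rfl fun μ _ => ?_
  rw [smul_smul, smul_smul]
  congr 1
  push_cast
  ring

theorem sum_alpha_polVec (p : Spacetime s) (l : ℤ) (m : ℕ) (i : ℕ) :
    ∑ μ, (eta μ : ℂ) • alpha p (-((i : ℤ) + 1)) μ
        (alpha p (m + ((i : ℤ) + 1)) μ (polVec n k e κ l)) =
      MvPolynomial.C (κ : ℂ) ^ m * (MvPolynomial.C (κ : ℂ) ^ i *
        (((m : Fock₀ s) + (i : Fock₀ s) + 1) * (osc e i * expVec n k κ (l - m - 1 - i)) -
          (n : Fock₀ s) * (osc k i * polVec n k e κ (l - m - 1 - i)))) := by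
  have h (μ : Fin (s + 1)) := alpha_polVec n k e κ p (m + i) μ l
  simp only [Nat.cast_add] at h
  simp only [← add_assoc] at h ⊢
  simp only [h, alpha_neg_succ, mul_sub, smul_sub, Finset.sum_sub_distrib]
  rw [sum_osc, sum_osc, show l - 1 - ((m : ℤ) + i) = l - m - 1 - i by ring,
    MvPolynomial.smul_eq_C_mul, MvPolynomial.smul_eq_C_mul]
  push_cast
  simp only [map_mul, map_pow, map_natCast, map_add, map_one, pow_add]
  ring

/-- The polarization enters linearly, so contracting two annihilators produces only k·e (in two
orders) and k·k, never e·e. -/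
theorem sum_eta_alpha_polVec_eq_zero (hkk : minkowski k k = 0) (hke : minkowski k e = 0)
    (p : Spacetime s) (l : ℤ) (a a' : ℕ) :
    ∑ μ, (eta μ : ℂ) • alpha p ((a : ℤ) + 1) μ (alpha p ((a' : ℤ) + 1) μ (polVec n k e κ l)) =
      0 := by
  have h (c : ℝ) (v u : Spacetime s) (huv : minkowski u v = 0) (χ : Fock₀ s) :
      ∑ μ, ((c * (eta μ * u μ * v μ) : ℝ) : ℂ) • χ = 0 := by
    rw [← Finset.sum_smul, ← Complex.ofReal_sum, ← Finset.mul_sum]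
    change ((c * minkowski u v : ℝ) : ℂ) • χ = 0
    rw [huv, mul_zero, Complex.ofReal_zero, zero_smul]
  have h1 := h (-(n * κ ^ a * (κ ^ a' * (a' + 1)))) e k hke (expVec n k κ (l - 1 - a' - 1 - a))
  have h2 := h (-(κ ^ a' * n * (κ ^ a * (a + 1)))) e k hke (expVec n k κ (l - 1 - a' - 1 - a))
  have h3 := h (κ ^ a' * n * (κ ^ a * n)) k k hkk (polVec n k e κ (l - 1 - a' - 1 - a))
  have h4 := congrArg₂ (· + ·) (congrArg₂ (· + ·) h1 h2) h3
  simp only [← Finset.sum_add_distrib, add_zero] at h4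
  rw [← h4]
  refine Finset.sum_congr rfl fun μ _ => ?_
  rw [alpha_polVec, map_sub, map_smul, map_smul, alpha_expVec, alpha_polVec]
  simp only [MvPolynomial.smul_eq_C_mul]
  push_cast
  simp only [map_mul, map_pow, map_natCast, map_add, map_one, map_neg]
  ring

/-- The zero mode p·α_m contributes -n κ^m v and the other terms (m + (n - m)) κ^m v, where v is the
coefficient of degree n - m. They cancel because the factor n in the exponent equals the level. -/
theorem virasoro_polVec (b : ℝ) (p : Spacetime s) (hkk : minkowski k k = 0)
    (hke : minkowski k e = 0) (hep : minkowski e p = 0) (hκ : minkowski k p = κ) (m : ℤ)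
    (hm : 0 < m) : virasoro b p m (polVec n k e κ n) = 0 := by
  obtain ⟨M, rfl⟩ : ∃ M : ℕ, m = (M + 1 : ℕ) := ⟨(m - 1).toNat, by omega⟩
  rw [virasoro, if_neg hm.ne', zero_smul, sub_zero, wickSum_eq_sum p (M + 1) (n + 1)]
  · rw [Finset.sum_range_succ']
    simp only [Nat.cast_zero, neg_zero, alpha_zero, add_zero, Nat.cast_succ]
    have h1 (i : ℕ) := sum_alpha_polVec n k e κ p n (M + 1) i
    simp only [Nat.cast_succ] at h1
    simp only [h1, alpha_polVec, smul_sub, Finset.sum_sub_distrib]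
    rw [sum_smul_minkowski, sum_smul_minkowski, hep, hκ, ← Finset.mul_sum]
    have h2 := sum_polCoeff_weighted n (MvPolynomial.C (κ : ℂ)) (osc k) (osc e)
      ((M : Fock₀ s) + 1) (n - (M + 1)) n (by omega)
    unfold expVec polVec
    rw [h2, mul_zero, Complex.ofReal_zero, zero_smul, zero_sub,
      show (n - 1 - M : ℤ) = n - (M + 1) by ring, MvPolynomial.smul_eq_C_mul]
    push_cast
    simp only [map_mul, map_pow, map_natCast]
    ring
  · intro j hj hjm
    obtain ⟨a, rfl⟩ : ∃ a : ℕ, j = a + 1 := ⟨(j - 1).toNat, by omega⟩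
    obtain ⟨a', ha'⟩ : ∃ a' : ℕ, ((M + 1 : ℕ) : ℤ) - (a + 1) = a' + 1 :=
      ⟨(((M + 1 : ℕ) : ℤ) - (a + 1) - 1).toNat, by omega⟩
    rw [ha']
    exact sum_eta_alpha_polVec_eq_zero n k e κ hkk hke p n a' a
  · omega
  · intro j hj
    exact alpha_polVec_eq_zero n k e κ p n j (by omega)

/-! ### The level operator, and the vacuum. -/

theorem number_eq_sum (χ : Fock₀ s) (L : ℕ) (hL : ∀ j : ℤ, (L : ℤ) < j → ∀ μ, alpha 0 j μ χ = 0) :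
    number χ = ∑ i ∈ Finset.range L, ∑ μ, (eta μ : ℂ) •
      alpha 0 (-((i : ℤ) + 1)) μ (alpha 0 ((i : ℤ) + 1) μ χ) := by
  have h := wickSum_eq_sum (0 : Spacetime s) 0 (L + 1) χ (fun j h1 h2 => by omega) (fun _ => rfl)
    (fun j hj => hL j (by omega))
  rw [Nat.cast_zero] at h
  rw [number, h, Finset.sum_range_succ']
  simp [alpha_zero]

theorem number_polVec : number (polVec n k e κ n) = (n : ℂ) • polVec n k e κ n := by
  rw [number_eq_sum _ n (fun j hj => alpha_polVec_eq_zero n k e κ 0 n j hj)]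
  have h1 (i : ℕ) := sum_alpha_polVec n k e κ 0 n 0 i
  simp only [Nat.cast_zero, zero_add, pow_zero, one_mul, sub_zero] at h1
  simp only [h1]
  have h2 := sum_polCoeff_weighted n (MvPolynomial.C (κ : ℂ)) (osc k) (osc e) 0 n n le_rfl
  simp only [zero_add] at h2
  unfold expVec polVec
  rw [h2, MvPolynomial.smul_eq_C_mul, map_natCast, Int.cast_natCast]

theorem number_one : number (1 : Fock₀ s) = 0 := by
  rw [number_eq_sum 1 0]
  · simp
  · intro j hj μ
    obtain ⟨a, rfl⟩ : ∃ a : ℕ, j = a + 1 := ⟨(j - 1).toNat, by omega⟩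
    rw [alpha_succ, MvPolynomial.pderiv_one, smul_zero]

theorem virasoro_one (b : ℝ) (p : Spacetime s) (m : ℤ) (hm : 0 < m) :
    virasoro b p m (1 : Fock₀ s) = 0 := by
  have h (j : ℤ) (hj : 0 < j) (μ : Fin (s + 1)) : alpha p j μ (1 : Fock₀ s) = 0 := by
    obtain ⟨a, rfl⟩ : ∃ a : ℕ, j = a + 1 := ⟨(j - 1).toNat, by omega⟩
    rw [alpha_succ, MvPolynomial.pderiv_one, smul_zero]
  obtain ⟨M, rfl⟩ : ∃ M : ℕ, m = (M + 1 : ℕ) := ⟨(m - 1).toNat, by omega⟩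
  rw [virasoro, if_neg hm.ne', zero_smul, sub_zero, wickSum_eq_sum p (M + 1) 0]
  · simp
  · intro j hj _
    simp [h j hj]
  · omega
  · intro j hj
    exact h j (by omega)

end

section

/-! ### Physical vectors in the algebraic Fock space -/

variable {s : ℕ}

theorem wickSum_add (p : Spacetime s) (m : ℤ) (χ ξ : Fock₀ s) :
    wickSum p m (χ + ξ) = wickSum p m χ + wickSum p m ξ := by
  unfold wickSum
  rw [← smul_add, ← finsum_add_distrib (finite_support_wick p m χ) (finite_support_wick p m ξ)]
  simp only [map_add, smul_add, Finset.sum_add_distrib]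

theorem wickSum_smul (p : Spacetime s) (m : ℤ) (c : ℂ) (χ : Fock₀ s) :
    wickSum p m (c • χ) = c • wickSum p m χ := by
  unfold wickSum
  rw [smul_comm c, smul_finsum c]
  congr 1
  refine finsum_congr fun j => ?_
  rw [Finset.smul_sum]
  exact Finset.sum_congr rfl fun μ _ => by rw [map_smul, smul_comm]

/-- The vectors of level `n` annihilated by all `L_m(p)`, `m > 0`. -/
def physicalVectors (b : ℝ) (n : ℕ) (p : Spacetime s) : Submodule ℂ (Fock₀ s) where
  carrier := {χ | number χ = (n : ℂ) • χ ∧ ∀ m : ℤ, 0 < m → virasoro b p m χ = 0}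
  add_mem' := by
    rintro χ ξ ⟨h1, h2⟩ ⟨h3, h4⟩
    refine ⟨?_, fun m hm => ?_⟩
    · rw [number, wickSum_add, smul_add, ← h1, ← h3]
      rfl
    · have h5 := h2 m hm
      have h6 := h4 m hm
      unfold virasoro at h5 h6 ⊢
      rw [wickSum_add, smul_add, add_sub_add_comm, h5, h6, add_zero]
  zero_mem' := by
    have h (p : Spacetime s) (m : ℤ) : wickSum p m 0 = 0 := by
      simpa using wickSum_smul p m 0 (0 : Fock₀ s)
    refine ⟨?_, fun m hm => ?_⟩
    · rw [number, h, smul_zero]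
    · rw [virasoro, h, smul_zero, sub_zero]
  smul_mem' := by
    rintro c χ ⟨h1, h2⟩
    refine ⟨?_, fun m hm => ?_⟩
    · rw [number, wickSum_smul, smul_comm, ← h1]
      rfl
    · have h5 := h2 m hm
      unfold virasoro at h5 ⊢
      rw [wickSum_smul, smul_comm _ c χ, ← smul_sub, h5, smul_zero]

theorem massSq_of_number {b : ℝ} {n : ℕ} {χ : Fock₀ s} (h : number χ = (n : ℂ) • χ) :
    massSq b χ = ((massLevel b n : ℝ) : ℂ) • χ := by
  rw [massSq, h, ← sub_smul, smul_smul, massLevel]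
  push_cast
  rfl

theorem number_of_massSq {b : ℝ} {n : ℕ} {χ : Fock₀ s}
    (h : massSq b χ = ((massLevel b n : ℝ) : ℂ) • χ) : number χ = (n : ℂ) • χ := by
  rw [massSq, massLevel] at h
  push_cast at h
  rw [mul_smul] at h
  have h1 := smul_right_injective (Fock₀ s) (two_ne_zero (α := ℂ)) h
  rw [sub_smul] at h1
  exact sub_left_injective h1

theorem isPhysicalAt_embed {b : ℝ} {n : ℕ} {p : Spacetime s} {χ : Fock₀ s}
    (h : χ ∈ physicalVectors b n p) : IsPhysicalAt b (massLevel b n) p (embed χ) := by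
  refine ⟨subset_closure ⟨χ, ?_⟩, fun m hm => subset_closure ⟨χ, ?_⟩⟩
  · simp [massSq_of_number h.1]
  · simp [h.2 m hm]

theorem isPhysicalAt_zero (b : ℝ) (n : ℕ) (p : Spacetime s) :
    IsPhysicalAt b (massLevel b n) p 0 := by
  have := isPhysicalAt_embed (zero_mem (physicalVectors (s := s) b n p))
  rwa [map_zero] at this

/-! ### The indefinite form -/

/-- The indefinite form on the algebraic Fock space. -/
def form (χ ξ : Fock₀ s) : ℂ := inner ℂ (embed χ) (fundSymm s (embed ξ))

theorem form_eq_tsum (χ ξ : Fock₀ s) :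
    form χ ξ = ∑' k, ((occNormSq k * timeSign k : ℝ) : ℂ) * (conj (χ.coeff k) * ξ.coeff k) := by
  unfold form
  rw [lp.inner_eq_tsum]
  refine tsum_congr fun k => ?_
  have h : fundSymm s (embed ξ) k = (timeSign k : ℂ) * embed ξ k := rfl
  rw [h, embed_apply, embed_apply, RCLike.inner_apply, map_mul, Complex.conj_ofReal]
  have h2 : (Real.sqrt (occNormSq k) : ℂ) * (Real.sqrt (occNormSq k) : ℂ) = occNormSq k := by
    rw [← Complex.ofReal_mul, Real.mul_self_sqrt (occNormSq_pos k).le]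
  push_cast
  rw [← h2]
  ring

theorem occNormSq_add_single (k : Mode s →₀ ℕ) (i : Mode s) :
    occNormSq (k + Finsupp.single i 1) = occNormSq k * ((i.1 : ℕ) * (k i + 1)) := by
  classical
  unfold occNormSq
  rw [← Finsupp.mul_prod_erase' k i _ (by simp),
    ← Finsupp.mul_prod_erase' (k + Finsupp.single i 1) i _ (by simp)]
  have h : (k + Finsupp.single i 1).erase i = k.erase i := by
    rw [Finsupp.erase_add, Finsupp.erase_single, add_zero]
  rw [h, Finsupp.add_apply, Finsupp.single_eq_same, pow_succ, Nat.factorial_succ]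
  push_cast
  ring

theorem timeSign_add_single (k : Mode s →₀ ℕ) (i : Mode s) :
    timeSign (k + Finsupp.single i 1) = timeSign k * eta i.2 := by
  classical
  unfold timeSign
  rw [← Finsupp.mul_prod_erase' k i _ (by simp),
    ← Finsupp.mul_prod_erase' (k + Finsupp.single i 1) i _ (by simp)]
  have h : (k + Finsupp.single i 1).erase i = k.erase i := by
    rw [Finsupp.erase_add, Finsupp.erase_single, add_zero]
  rw [h, Finsupp.add_apply, Finsupp.single_eq_same, pow_succ]
  ring

/-- Adjointness of α_{-m} and α_m: raising an occupation number k to k + 1 multiplies the weight by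
m (k + 1) η, which is exactly the factor produced by the derivative. -/
theorem form_X_mul (p : Spacetime s) (a : ℕ) (μ : Fin (s + 1)) (χ ξ : Fock₀ s) :
    form (MvPolynomial.X (a.succPNat, μ) * χ) ξ = form χ (alpha p ((a : ℤ) + 1) μ ξ) := by
  classical
  rw [form_eq_tsum, form_eq_tsum]
  have hinj : Function.Injective fun k : Mode s →₀ ℕ => k + Finsupp.single (a.succPNat, μ) 1 :=
    fun k l h => add_right_cancel h
  -- The left-hand series is supported on occupation numbers that contain the mode, so it is
  -- reindexed by removing one quantum.
  rw [← hinj.tsum_eq]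
  · refine tsum_congr fun k => ?_
    rw [add_comm k, MvPolynomial.coeff_X_mul, add_comm _ k, occNormSq_add_single,
      timeSign_add_single, alpha_succ, MvPolynomial.coeff_smul, MvPolynomial.coeff_pderiv,
      smul_eq_mul]
    simp only [Nat.succPNat_coe, Nat.succ_eq_add_one]
    push_cast
    ring
  · intro k hk
    rw [Function.mem_support, MvPolynomial.coeff_X_mul'] at hk
    split_ifs at hk with h
    · refine ⟨k - Finsupp.single (a.succPNat, μ) 1, tsub_add_cancel_of_le ?_⟩
      rw [Finsupp.single_le_iff, Nat.one_le_iff_ne_zero]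
      exact Finsupp.mem_support_iff.mp h
    · simp at hk

theorem form_sum_left {ι : Type*} (t : Finset ι) (f : ι → Fock₀ s) (ξ : Fock₀ s) :
    form (∑ i ∈ t, f i) ξ = ∑ i ∈ t, form (f i) ξ := by
  simp only [form, map_sum, sum_inner]

theorem form_smul_left (c : ℂ) (χ ξ : Fock₀ s) : form (c • χ) ξ = conj c * form χ ξ := by
  simp only [form, map_smul, inner_smul_left]

theorem form_smul_right (c : ℂ) (χ ξ : Fock₀ s) : form χ (c • ξ) = c * form χ ξ := by
  simp only [form, map_smul, inner_smul_right]

theorem form_sub_right (χ ξ ζ : Fock₀ s) : form χ (ξ - ζ) = form χ ξ - form χ ζ := by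
  simp only [form, map_sub, inner_sub_right]

theorem form_osc_mul (v : Spacetime s) (a : ℕ) (χ ξ : Fock₀ s) :
    form (osc v a * χ) ξ =
      ∑ μ, ((eta μ * v μ : ℝ) : ℂ) * form χ (alpha 0 ((a : ℤ) + 1) μ ξ) := by
  unfold osc
  rw [Finset.sum_mul, form_sum_left]
  refine Finset.sum_congr rfl fun μ _ => ?_
  rw [mul_assoc, ← MvPolynomial.smul_eq_C_mul, form_smul_left, Complex.conj_ofReal, form_X_mul 0]

theorem form_one_one : form (1 : Fock₀ s) 1 = 1 := by
  classical
  rw [form_eq_tsum, tsum_eq_single 0]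
  · simp [occNormSq, timeSign]
  · intro k hk
    rw [MvPolynomial.coeff_one, if_neg hk.symm]
    simp

variable (n : ℕ) (k e : Spacetime s) (κ : ℝ)

theorem form_osc_mul_expVec (v : Spacetime s) (a : ℕ) (l : ℤ) (χ : Fock₀ s) :
    form (osc v a * χ) (expVec n k κ l) =
      -((n * κ ^ a * minkowski v k : ℝ) : ℂ) * form χ (expVec n k κ (l - 1 - a)) := by
  rw [form_osc_mul]
  simp only [alpha_expVec, form_smul_right, minkowski]
  rw [Finset.mul_sum, Complex.ofReal_sum, ← Finset.sum_neg_distrib, Finset.sum_mul]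
  refine Finset.sum_congr rfl fun μ _ => ?_
  push_cast
  ring

theorem form_osc_mul_polVec (v : Spacetime s) (a : ℕ) (l : ℤ) (χ : Fock₀ s) :
    form (osc v a * χ) (polVec n k e κ l) =
      ((κ ^ a * (a + 1) * minkowski v e : ℝ) : ℂ) * form χ (expVec n k κ (l - 1 - a)) -
      ((κ ^ a * n * minkowski v k : ℝ) : ℂ) * form χ (polVec n k e κ (l - 1 - a)) := by
  rw [form_osc_mul]
  simp only [alpha_polVec, form_sub_right, form_smul_right, minkowski]
  rw [Finset.mul_sum, Finset.mul_sum, Complex.ofReal_sum, Complex.ofReal_sum, Finset.sum_mul,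
    Finset.sum_mul, ← Finset.sum_sub_distrib]
  refine Finset.sum_congr rfl fun μ _ => ?_
  push_cast
  ring

/-- By the recursion, l times the coefficient is a sum of products with some k·α_{-i}, and each of
these pairs with the exponential to a multiple of k·k = 0. -/
theorem form_expVec_self (hkk : minkowski k k = 0) (l : ℤ) :
    form (expVec n k κ l) (expVec n k κ l) = if l = 0 then 1 else 0 := by
  split_ifs with h
  · rw [h, expVec, expCoeff_zero, form_one_one]
  · have h1 := mul_expCoeff n (MvPolynomial.C (κ : ℂ)) (osc k) l l.toNat (by omega)
    have h2 : form ((l : ℂ) • expVec n k κ l) (expVec n k κ l) = 0 := by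
      have h3 : (l : ℂ) • expVec n k κ l = ∑ i ∈ Finset.range l.toNat,
          (-(n : ℂ) * (κ : ℂ) ^ i) • (osc k i * expVec n k κ (l - 1 - i)) := by
        rw [MvPolynomial.smul_eq_C_mul, map_intCast, expVec, h1]
        refine Finset.sum_congr rfl fun i _ => ?_
        rw [MvPolynomial.smul_eq_C_mul]
        simp only [map_mul, map_neg, map_pow, map_natCast]
        unfold expVec
        ring
      rw [h3, form_sum_left]
      refine Finset.sum_eq_zero fun i _ => ?_
      rw [form_smul_left, form_osc_mul_expVec, hkk]
      simp
    rw [form_smul_left, mul_eq_zero, map_intCast, Int.cast_eq_zero] at h2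
    exact h2.resolve_left h

/-- Since e·k = 0, the oscillator e·α_{-(j+1)} pairs only with the polarization on the right. This
leaves norms of exponential coefficients, nonzero only in degree 0, that is for j = n - 1. -/
theorem form_polVec_self (hkk : minkowski k k = 0) (hek : minkowski e k = 0) (hn : n ≠ 0) :
    form (polVec n k e κ n) (polVec n k e κ n) =
      ((n * κ ^ (2 * (n - 1)) * minkowski e e : ℝ) : ℂ) := by
  have h1 : polVec n k e κ n = ∑ j ∈ Finset.range n,
      ((κ : ℂ) ^ j) • (osc e j * expVec n k κ (n - 1 - j)) := by
    rw [polVec, polCoeff_eq_sum _ _ _ _ _ n le_rfl]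
    refine Finset.sum_congr rfl fun j _ => ?_
    rw [MvPolynomial.smul_eq_C_mul, map_pow, expVec, mul_assoc]
  conv_lhs => arg 1; rw [h1]
  rw [form_sum_left, Finset.sum_eq_single (n - 1)]
  · rw [form_smul_left, form_osc_mul_polVec, hek, form_expVec_self n k κ hkk, if_pos (by omega)]
    obtain ⟨m, rfl⟩ : ∃ m, n = m + 1 := ⟨n - 1, by omega⟩
    simp only [Nat.add_sub_cancel, map_pow, Complex.conj_ofReal]
    push_cast
    ring
  · intro j hj hjn
    rw [Finset.mem_range] at hj
    rw [form_smul_left, form_osc_mul_polVec, hek, form_expVec_self n k κ hkk, if_neg (by omega)]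
    simp
  · intro h
    rw [Finset.mem_range] at h
    omega

/-! ### The transversal vectors -/

theorem minkowski_comm (p x : Spacetime s) : minkowski p x = minkowski x p := by
  unfold minkowski
  exact Finset.sum_congr rfl fun μ _ => by ring

theorem minkowski_sub_smul_right (x v w : Spacetime s) (c d : ℝ) :
    minkowski x (c • v - d • w) = c * minkowski x v - d * minkowski x w := by
  unfold minkowski
  rw [Finset.mul_sum, Finset.mul_sum, ← Finset.sum_sub_distrib]
  refine Finset.sum_congr rfl fun μ _ => ?_
  simp only [PiLp.sub_apply, PiLp.smul_apply, smul_eq_mul]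
  ring

/-- The polarization vector built from `k` and `t`, orthogonal to the momentum `p`. -/
def polarization (k t p : Spacetime s) : Spacetime s := minkowski k p • t - minkowski t p • k

/-- The physical vector of level `n` and momentum `p` with one transversal oscillator. -/
def transversal (n : ℕ) (k t p : Spacetime s) : Fock₀ s :=
  if n = 0 then 1 else polVec n k (polarization k t p) (minkowski k p) n

variable (t p : Spacetime s)

theorem transversal_mem (b : ℝ) (hkk : minkowski k k = 0) (hkt : minkowski k t = 0) :
    transversal n k t p ∈ physicalVectors b n p := by
  unfold transversal
  split_ifs with h
  · refine ⟨?_, fun m hm => virasoro_one b p m hm⟩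
    rw [number_one, h, Nat.cast_zero, zero_smul]
  · refine ⟨number_polVec n k _ _, fun m hm => virasoro_polVec n k _ _ b p hkk ?_ ?_ rfl m hm⟩
    · rw [polarization, minkowski_sub_smul_right, hkt, hkk]
      ring
    · rw [minkowski_comm, polarization, minkowski_sub_smul_right, minkowski_comm p t,
        minkowski_comm p k]
      ring

/-- The polarization has square (k·p)², so the norm is n (k·p)^(2n) for n > 0, and it is 1 for the
vacuum. -/
theorem form_transversal_self (hkk : minkowski k k = 0) (hkt : minkowski k t = 0)
    (htt : minkowski t t = 1) : ∃ c : ℝ, 0 ≤ c ∧ (minkowski k p ≠ 0 → 0 < c) ∧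
      form (transversal n k t p) (transversal n k t p) = c := by
  unfold transversal
  split_ifs with h
  · exact ⟨1, zero_le_one, fun _ => zero_lt_one, by rw [form_one_one, Complex.ofReal_one]⟩
  · have h1 : minkowski (polarization k t p) k = 0 := by
      rw [minkowski_comm, polarization, minkowski_sub_smul_right, hkt, hkk]
      ring
    have h2 : minkowski (polarization k t p) (polarization k t p) = minkowski k p ^ 2 := by
      conv_lhs => arg 2; rw [polarization]
      rw [minkowski_sub_smul_right, h1, minkowski_comm _ t, polarization,
        minkowski_sub_smul_right, htt, minkowski_comm t k, hkt]
      ring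
    refine ⟨_, ?_, fun hκ => ?_, form_polVec_self n k _ _ hkk h1 h⟩
    · rw [h2, pow_mul]
      positivity
    · rw [h2, pow_mul]
      have : 0 < n := Nat.pos_of_ne_zero h
      positivity

theorem osc_polarization (i : ℕ) : osc (polarization k t p) i =
    MvPolynomial.C (minkowski k p : ℂ) * osc t i - MvPolynomial.C (minkowski t p : ℂ) * osc k i := by
  unfold osc
  rw [Finset.mul_sum, Finset.mul_sum, ← Finset.sum_sub_distrib]
  refine Finset.sum_congr rfl fun μ _ => ?_
  simp only [polarization, PiLp.sub_apply, PiLp.smul_apply, smul_eq_mul]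
  push_cast
  simp only [map_mul, map_sub]
  ring

/-- The vectors `transversal n k t p` depend polynomially on the momentum `p`. -/
theorem exists_polynomial_transversal :
    ∃ Ξ : MvPolynomial (Mode s) (MvPolynomial (Fin (s + 1)) ℂ), ∀ p : Spacetime s,
      MvPolynomial.map (MvPolynomial.eval fun μ => (p μ : ℂ)) Ξ = transversal n k t p := by
  let oscL (v : Spacetime s) (i : ℕ) : MvPolynomial (Mode s) (MvPolynomial (Fin (s + 1)) ℂ) :=
    ∑ μ, MvPolynomial.C (MvPolynomial.C ((eta μ * v μ : ℝ) : ℂ)) *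
      MvPolynomial.X (i.succPNat, μ)
  let minkL (v : Spacetime s) : MvPolynomial (Mode s) (MvPolynomial (Fin (s + 1)) ℂ) :=
    MvPolynomial.C (∑ μ, MvPolynomial.C ((eta μ * v μ : ℝ) : ℂ) * MvPolynomial.X μ)
  have h1 (p v : Spacetime s) (i : ℕ) :
      MvPolynomial.map (MvPolynomial.eval fun μ => (p μ : ℂ)) (oscL v i) = osc v i := by
    simp [oscL, osc]
  have h2 (p v : Spacetime s) :
      MvPolynomial.map (MvPolynomial.eval fun μ => (p μ : ℂ)) (minkL v) =
        MvPolynomial.C (minkowski v p : ℂ) := by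
    simp [minkL, minkowski]
  -- The recursion is run over the ring of polynomials in p. Evaluation at a momentum is a ring
  -- homomorphism, hence commutes with it, and the polarization is linear in p.
  refine ⟨if n = 0 then 1 else polCoeff n (minkL k) (oscL k)
    (fun i => minkL k * oscL t i - minkL t * oscL k i) n, fun p => ?_⟩
  unfold transversal
  split_ifs with h
  · exact map_one _
  · rw [map_polCoeff, polVec]
    congr 1
    · exact h2 p k
    · funext i
      exact h1 p k i
    · funext i
      rw [map_sub, map_mul, map_mul, h1, h1, h2, h2, osc_polarization]

/-! ### Conjugation -/

/-- The conjugation `fibreConj` on the algebraic Fock space. -/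
def conjVec : Fock₀ s →+* Fock₀ s :=
  MvPolynomial.eval₂Hom (MvPolynomial.C.comp (starRingEnd ℂ)) fun i =>
    MvPolynomial.C ((-eta i.2 : ℝ) : ℂ) * MvPolynomial.X i

theorem conjVec_C (c : ℂ) : conjVec (MvPolynomial.C c : Fock₀ s) = MvPolynomial.C (conj c) := by
  simp [conjVec]

theorem coeff_conjVec (χ : Fock₀ s) (k : Mode s →₀ ℕ) :
    (conjVec χ).coeff k = (spaceSign k : ℂ) * conj (χ.coeff k) := by
  classical
  induction χ using MvPolynomial.induction_on' with
  | monomial l c =>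
    have h : conjVec (MvPolynomial.monomial l c) =
        MvPolynomial.monomial l ((spaceSign l : ℂ) * conj c) := by
      rw [conjVec, MvPolynomial.coe_eval₂Hom, MvPolynomial.eval₂_monomial,
        MvPolynomial.monomial_eq, Finsupp.prod, spaceSign, Finsupp.prod, Finsupp.prod]
      simp only [mul_pow, Finset.prod_mul_distrib, RingHom.comp_apply]
      push_cast
      simp only [map_mul, map_prod, map_pow]
      ring
    rw [h, MvPolynomial.coeff_monomial, MvPolynomial.coeff_monomial]
    split_ifs with h'
    · rw [h']
    · simp
  | add χ ξ h1 h2 => rw [map_add, MvPolynomial.coeff_add, h1, h2, MvPolynomial.coeff_add, map_add,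
      mul_add]

theorem fibreConj_smul_embed (c : ℂ) (χ : Fock₀ s) :
    fibreConj (c • embed χ) = conj c • embed (conjVec χ) := by
  ext l
  change (spaceSign l : ℂ) * conj (c * embed χ l) = conj c * embed (conjVec χ) l
  rw [embed_apply, embed_apply, coeff_conjVec, map_mul, map_mul, Complex.conj_ofReal]
  ring

theorem eta_mul_spaceReflection (v : Spacetime s) (μ : Fin (s + 1)) :
    eta μ * spaceReflection v μ = -v μ := by
  simp only [spaceReflection, eta]
  split_ifs <;> simp

theorem spaceReflection_apply_mul (v w : Spacetime s) (μ : Fin (s + 1)) :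
    spaceReflection v μ * spaceReflection w μ = v μ * w μ := by
  simp only [spaceReflection]
  split_ifs <;> simp

theorem minkowski_spaceReflection (v w : Spacetime s) :
    minkowski (spaceReflection v) (spaceReflection w) = minkowski v w := by
  unfold minkowski
  refine Finset.sum_congr rfl fun μ _ => ?_
  rw [mul_assoc, spaceReflection_apply_mul, mul_assoc]

theorem spaceReflection_spaceReflection (v : Spacetime s) :
    spaceReflection (spaceReflection v) = v := by
  ext μ
  simp only [spaceReflection]
  split_ifs <;> simp

theorem conjVec_osc (v : Spacetime s) (i : ℕ) :
    conjVec (osc v i) = osc (spaceReflection v) i := by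
  unfold osc
  rw [map_sum]
  refine Finset.sum_congr rfl fun μ _ => ?_
  have h : conjVec (MvPolynomial.X (i.succPNat, μ) : Fock₀ s) =
      MvPolynomial.C ((-eta μ : ℝ) : ℂ) * MvPolynomial.X (i.succPNat, μ) := by
    simp [conjVec]
  rw [map_mul, conjVec_C, h, ← mul_assoc, Complex.conj_ofReal, ← map_mul, ← Complex.ofReal_mul,
    eta_mul_spaceReflection, show eta μ * v μ * -eta μ = -(eta μ * eta μ * v μ) by ring,
    eta_mul_self, one_mul]

/-- Conjugation reflects the vector in each oscillator, while the scalars are real Minkowski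
products and hence reflection invariant. -/
theorem conjVec_transversal : conjVec (transversal n k t p) =
    transversal n (spaceReflection k) (spaceReflection t) (spaceReflection p) := by
  unfold transversal
  split_ifs with h
  · exact map_one _
  · rw [polVec, polVec, map_polCoeff]
    congr 1
    · rw [conjVec_C, Complex.conj_ofReal, minkowski_spaceReflection]
    · funext i
      exact conjVec_osc k i
    · funext i
      simp only [osc_polarization, map_sub, map_mul, conjVec_C, conjVec_osc, Complex.conj_ofReal,
        minkowski_spaceReflection]

end

section

/-! ### The mass projections -/

variable {s : ℕ}

/-- N is diagonal in the occupation number basis, which makes different levels orthogonal. The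
cutoff L costs nothing, as χ contains no higher modes. -/
theorem coeff_number (χ : Fock₀ s) (L : ℕ) (hL : ∀ j : ℤ, (L : ℤ) < j → ∀ μ, alpha 0 j μ χ = 0)
    (k : Mode s →₀ ℕ) : (number χ).coeff k =
      ((∑ i ∈ Finset.range L, ∑ μ, (i + 1) * k (i.succPNat, μ) : ℕ) : ℂ) * χ.coeff k := by
  classical
  rw [number_eq_sum χ L hL, MvPolynomial.coeff_sum, Nat.cast_sum, Finset.sum_mul]
  refine Finset.sum_congr rfl fun i _ => ?_
  rw [MvPolynomial.coeff_sum, Nat.cast_sum, Finset.sum_mul]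
  refine Finset.sum_congr rfl fun μ _ => ?_
  rw [alpha_neg_succ, alpha_succ, MvPolynomial.coeff_smul, MvPolynomial.coeff_X_mul']
  have h : (eta μ : ℂ) * eta μ = 1 := by
    rw [← Complex.ofReal_mul, eta_mul_self, Complex.ofReal_one]
  split_ifs with hk
  · have h1 : Finsupp.single (i.succPNat, μ) 1 ≤ k := by
      rw [Finsupp.single_le_iff, Nat.one_le_iff_ne_zero]
      exact Finsupp.mem_support_iff.mp hk
    have h2 : k (i.succPNat, μ) - 1 + 1 = k (i.succPNat, μ) :=
      Nat.sub_add_cancel (Nat.one_le_iff_ne_zero.mpr (Finsupp.mem_support_iff.mp hk))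
    rw [MvPolynomial.coeff_smul, MvPolynomial.coeff_pderiv, tsub_add_cancel_of_le h1,
      Finsupp.tsub_apply, Finsupp.single_eq_same, ← Nat.cast_add_one, h2, smul_eq_mul, smul_eq_mul]
    push_cast
    linear_combination ((i : ℂ) + 1) * (MvPolynomial.coeff k χ * k (i.succPNat, μ)) * h
  · rw [Finsupp.notMem_support_iff.mp hk]
    simp

theorem inner_embed_of_number {m n : ℕ} (hmn : m ≠ n) {χ ξ : Fock₀ s}
    (hχ : number χ = (m : ℂ) • χ) (hξ : number ξ = (n : ℂ) • ξ) :
    inner ℂ (embed χ) (embed ξ) = 0 := by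
  obtain ⟨L₁, h₁⟩ := alpha_eventually_zero 0 χ
  obtain ⟨L₂, h₂⟩ := alpha_eventually_zero 0 ξ
  rw [lp.inner_eq_tsum]
  refine (tsum_congr fun k => ?_).trans tsum_zero
  have h3 := coeff_number χ (max L₁ L₂) (fun j hj => h₁ j (by omega)) k
  have h4 := coeff_number ξ (max L₁ L₂) (fun j hj => h₂ j (by omega)) k
  rw [hχ, MvPolynomial.coeff_smul, smul_eq_mul] at h3
  rw [hξ, MvPolynomial.coeff_smul, smul_eq_mul] at h4
  rw [embed_apply, embed_apply]
  by_cases h5 : χ.coeff k = 0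
  · simp [h5]
  · by_cases h6 : ξ.coeff k = 0
    · simp [h6]
    · have h7 := (mul_right_cancel₀ h5 h3).trans (mul_right_cancel₀ h6 h4).symm
      exact absurd (Nat.cast_injective h7) hmn

theorem massProj_embed_self {b : ℝ} {n : ℕ} {χ : Fock₀ s} (h : number χ = (n : ℂ) • χ) :
    massProj b (massLevel b n) (embed χ) = embed χ := by
  unfold massProj
  rw [Submodule.starProjection_eq_self_iff]
  exact Submodule.le_topologicalClosure _
    (Submodule.subset_span (Set.mem_image_of_mem _ (massSq_of_number h)))

theorem massProj_embed_of_ne {b : ℝ} {m n : ℕ} (hmn : m ≠ n) {χ : Fock₀ s}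
    (h : number χ = (n : ℂ) • χ) : massProj b (massLevel b m) (embed χ) = 0 := by
  unfold massProj
  rw [Submodule.starProjection_apply_eq_zero_iff, Submodule.orthogonal_closure,
    Submodule.mem_orthogonal]
  intro u hu
  induction hu using Submodule.span_induction with
  | mem x hx =>
    obtain ⟨ξ, hξ, rfl⟩ := hx
    exact inner_embed_of_number hmn (number_of_massSq hξ) h
  | zero => exact inner_zero_left _
  | add x y _ _ hx hy => rw [inner_add_left, hx, hy, add_zero]
  | smul c x _ hx => rw [inner_smul_left, hx, mul_zero]

/-! ### The mass shell -/

theorem norm_event_sq (t : ℝ) (q : EuclideanSpace ℝ (Fin s)) :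
    ‖event t q‖ ^ 2 = t ^ 2 + ‖q‖ ^ 2 := by
  rw [EuclideanSpace.norm_sq_eq, EuclideanSpace.norm_sq_eq, Fin.sum_univ_succ]
  simp [event]

theorem continuous_shell (r : ℝ) :
    Continuous fun q : EuclideanSpace ℝ (Fin s) => event (1 * Real.sqrt (‖q‖ ^ 2 + r)) q := by
  unfold event
  refine (PiLp.continuous_toLp 2 _).comp (continuous_pi fun μ => ?_)
  refine Fin.cases ?_ (fun i => ?_) μ
  · simp only [Fin.cons_zero]
    fun_prop
  · simp only [Fin.cons_succ]
    fun_prop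

theorem measurable_shellDensity (r : ℝ) : Measurable fun q : EuclideanSpace ℝ (Fin s) =>
    ENNReal.ofReal (1 / (2 * Real.sqrt (‖q‖ ^ 2 + r))) := by
  fun_prop

/-! ### Square integrability on the mass shell. -/

theorem exists_sq_norm_le (h : 𝓢(Spacetime s, ℂ)) (K : ℕ) :
    ∃ C : ℝ, 0 ≤ C ∧ ∀ x, ‖h x‖ ^ 2 ≤ C * ((1 + ‖x‖) ^ K)⁻¹ := by
  obtain ⟨C, hC⟩ : ∃ C : ℝ, ∀ x, (1 + ‖x‖) ^ K * ‖h x‖ ≤ C := by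
    have h1 := SchwartzMap.one_add_le_sup_seminorm_apply (𝕜 := ℂ) (m := (K, 0)) (k := K) (n := 0)
      le_rfl le_rfl h
    simp only [norm_iteratedFDeriv_zero] at h1
    exact ⟨_, h1⟩
  have hC0 : 0 ≤ C := le_trans (by positivity) (hC 0)
  refine ⟨C ^ 2, by positivity, fun x => ?_⟩
  have h1 : (1 : ℝ) ≤ (1 + ‖x‖) ^ K := one_le_pow₀ (by linarith [norm_nonneg x])
  rw [← div_eq_mul_inv, le_div_iff₀ (by positivity)]
  calc ‖h x‖ ^ 2 * (1 + ‖x‖) ^ K ≤ ‖h x‖ ^ 2 * ((1 + ‖x‖) ^ K * (1 + ‖x‖) ^ K) := by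
        gcongr
        exact le_mul_of_one_le_left (by positivity) h1
    _ = ((1 + ‖x‖) ^ K * ‖h x‖) ^ 2 := by ring
    _ ≤ C ^ 2 := by
        gcongr
        exact hC x

/-- In polar coordinates the weight y^(s-1) absorbs the singularity 1/y because s ≥ 2, and what
remains is bounded by (1 + y)^(-2). -/
theorem integrable_inv_norm_mul (hs : 2 ≤ s) : Integrable fun q : EuclideanSpace ℝ (Fin s) =>
    ((1 + ‖q‖) ^ s)⁻¹ * ‖q‖⁻¹ := by
  have : Nonempty (Fin s) := ⟨⟨0, by omega⟩⟩
  refine (integrable_fun_norm_addHaar (volume : Measure (EuclideanSpace ℝ (Fin s)))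
    (f := fun y : ℝ => ((1 + y) ^ s)⁻¹ * y⁻¹)).mpr ?_
  rw [finrank_euclideanSpace_fin]
  have h1 : Integrable fun y : ℝ => (1 + ‖y‖) ^ (-(2 : ℝ)) :=
    integrable_one_add_norm (by simp)
  refine h1.integrableOn.mono' ?_ ?_
  · refine Measurable.aestronglyMeasurable ?_
    fun_prop
  · refine (ae_restrict_iff' measurableSet_Ioi).mpr (Filter.Eventually.of_forall fun y hy => ?_)
    have hy : 0 < y := hy
    rw [Real.norm_of_nonneg hy.le, Real.rpow_neg (by positivity), Real.rpow_two,
      Real.norm_of_nonneg (by rw [smul_eq_mul]; positivity), smul_eq_mul]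
    obtain ⟨m, rfl⟩ : ∃ m, s = m + 2 := ⟨s - 2, by omega⟩
    have h2 : y ^ (m + 2 - 1) * (((1 + y) ^ (m + 2))⁻¹ * y⁻¹) =
        (y ^ m * ((1 + y) ^ m)⁻¹) * ((1 + y) ^ 2)⁻¹ := by
      rw [show m + 2 - 1 = m + 1 by omega, pow_succ, pow_add]
      field_simp
    rw [h2]
    refine mul_le_of_le_one_left (by positivity) ?_
    rw [← div_eq_mul_inv]
    refine div_le_one_of_le₀ ?_ (by positivity)
    gcongr
    linarith

/-- The bound √(‖q‖² + r) ≥ ‖q‖ reduces every r ≥ 0 to the light cone, the only case with a singular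
density. -/
theorem memLp_shellMeasure (hs : 2 ≤ s) {r : ℝ} (hr : 0 ≤ r) (h : 𝓢(Spacetime s, ℂ)) :
    MemLp h 2 (shellMeasure s r) := by
  have : Nonempty (Fin s) := ⟨⟨0, by omega⟩⟩
  have hmeas : AEStronglyMeasurable h (shellMeasure s r) := h.continuous.aestronglyMeasurable
  rw [memLp_two_iff_integrable_sq_norm hmeas]
  obtain ⟨C, hC0, hC⟩ := exists_sq_norm_le h s
  have hsq : Continuous fun p => ‖h p‖ ^ 2 := h.continuous.norm.pow 2
  rw [shellMeasure, if_pos hr, halfShellMeasure, integrable_map_measure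
    hsq.aestronglyMeasurable (continuous_shell r).aemeasurable,
    integrable_withDensity_iff_integrable_smul' (measurable_shellDensity r)
      (Filter.Eventually.of_forall fun _ => ENNReal.ofReal_lt_top)]
  refine Integrable.mono' (((integrable_inv_norm_mul hs).const_mul C).restrict) ?_ ?_
  · refine Measurable.aestronglyMeasurable ?_
    refine (measurable_shellDensity r).ennreal_toReal.smul ?_
    exact (hsq.comp (continuous_shell r)).measurable
  · refine ae_restrict_of_ae ?_
    have h0 : ∀ᵐ q : EuclideanSpace ℝ (Fin s), q ≠ 0 := by
      simp [ae_iff]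
    filter_upwards [h0] with q hq
    have hq : 0 < ‖q‖ := norm_pos_iff.mpr hq
    have h1 : ‖q‖ ≤ Real.sqrt (‖q‖ ^ 2 + r) := Real.le_sqrt_of_sq_le (by linarith)
    have h2 : ‖q‖ ≤ ‖event (1 * Real.sqrt (‖q‖ ^ 2 + r)) q‖ := by
      refine le_of_sq_le_sq ?_ (norm_nonneg _)
      rw [norm_event_sq]
      nlinarith [sq_nonneg (1 * Real.sqrt (‖q‖ ^ 2 + r))]
    rw [ENNReal.toReal_ofReal (by positivity), smul_eq_mul, Function.comp_apply,
      Real.norm_of_nonneg (mul_nonneg (by positivity) (sq_nonneg _))]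
    calc 1 / (2 * Real.sqrt (‖q‖ ^ 2 + r)) * ‖h (event (1 * Real.sqrt (‖q‖ ^ 2 + r)) q)‖ ^ 2
        ≤ ‖q‖⁻¹ * (C * ((1 + ‖q‖) ^ s)⁻¹) := by
          refine mul_le_mul ?_ ((hC _).trans ?_) (by positivity) (by positivity)
          · rw [one_div]
            refine inv_anti₀ hq ?_
            linarith
          · gcongr
      _ = C * (((1 + ‖q‖) ^ s)⁻¹ * ‖q‖⁻¹) := by ring

/-- A property of momenta that holds almost everywhere on the mass shell holds somewhere on every
nonempty open part of it. -/
theorem exists_of_ae_shellMeasure {r : ℝ} (hr : 0 ≤ r) {P : Spacetime s → Prop}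
    (hP : ∀ᵐ p ∂(shellMeasure s r), P p) (U : Set (Spacetime s)) (hU : IsOpen U)
    (q₀ : EuclideanSpace ℝ (Fin s)) (hq₀ : 0 < ‖q₀‖ ^ 2 + r)
    (hmem : event (1 * Real.sqrt (‖q₀‖ ^ 2 + r)) q₀ ∈ U) : ∃ p ∈ U, P p := by
  rw [shellMeasure, if_pos hr, halfShellMeasure] at hP
  have h1 := ae_of_ae_map (continuous_shell r).aemeasurable hP
  rw [ae_withDensity_iff (measurable_shellDensity r)] at h1
  have hopen : IsOpen {q : EuclideanSpace ℝ (Fin s) | 0 < ‖q‖ ^ 2 + r} :=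
    isOpen_lt continuous_const (by fun_prop)
  rw [ae_restrict_iff' hopen.measurableSet] at h1
  have h2 := Measure.dense_of_ae h1
  obtain ⟨q, hq, hqP⟩ := h2.inter_open_nonempty _
    (hopen.inter (hU.preimage (continuous_shell r))) ⟨q₀, hq₀, hmem⟩
  refine ⟨_, hq.2, hqP hq.1 ?_⟩
  have h3 : 0 < ‖q‖ ^ 2 + r := hq.1
  have h4 : 0 < Real.sqrt (‖q‖ ^ 2 + r) := Real.sqrt_pos.mpr h3
  rw [Ne, ENNReal.ofReal_eq_zero, not_le]
  positivity

end

section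

/-! ### The Fourier transform of algebraic test functions -/

open scoped FourierTransform LineDeriv

variable {s : ℕ}

/-- The matrix of `p ↦ η p / 2π`. -/
def freqMatrix (s : ℕ) : Matrix (Fin (s + 1)) (Fin (s + 1)) ℝ :=
  Matrix.diagonal fun μ => eta μ / (2 * Real.pi)

theorem freqMatrix_apply (p : Spacetime s) (μ : Fin (s + 1)) :
    Matrix.toEuclideanLin (freqMatrix s) p μ = eta μ / (2 * Real.pi) * p μ := by
  change (freqMatrix s).mulVec p.ofLp μ = _
  rw [freqMatrix, Matrix.mulVec_diagonal]

theorem isUnit_det_freqMatrix : IsUnit (freqMatrix s).det := by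
  rw [freqMatrix, Matrix.det_diagonal, isUnit_iff_ne_zero]
  refine Finset.prod_ne_zero_iff.mpr fun μ _ => div_ne_zero ?_ (by positivity)
  unfold eta
  split_ifs <;> norm_num

/-- The Fourier transform of scalar test functions, in the normalization of `fourier`. -/
def hat (f : 𝓢(Spacetime s, ℂ)) (p : Spacetime s) : ℂ :=
  (((2 * Real.pi) ^ (-((s : ℝ) + 1) / 2) : ℝ) : ℂ) *
    (𝓕 f) (Matrix.toEuclideanLin (freqMatrix s) p)

theorem hat_eq_integral (f : 𝓢(Spacetime s, ℂ)) (p : Spacetime s) :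
    hat f p = (((2 * Real.pi) ^ (-((s : ℝ) + 1) / 2) : ℝ) : ℂ) *
      ∫ x, Complex.exp (-Complex.I * (minkowski p x : ℂ)) * f x := by
  unfold hat
  rw [SchwartzMap.fourier_coe, Real.fourier_eq']
  congr 2
  funext x
  have h : -2 * Real.pi * inner ℝ x (Matrix.toEuclideanLin (freqMatrix s) p) =
      -minkowski p x := by
    rw [PiLp.inner_apply, minkowski, Finset.mul_sum, ← Finset.sum_neg_distrib]
    refine Finset.sum_congr rfl fun μ _ => ?_
    rw [freqMatrix_apply]
    simp only [RCLike.inner_apply, conj_trivial]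
    field_simp
  rw [h, smul_eq_mul]
  congr 2
  push_cast
  ring

theorem hat_add (f g : 𝓢(Spacetime s, ℂ)) (p : Spacetime s) :
    hat (f + g) p = hat f p + hat g p := by
  unfold hat
  rw [FourierTransform.fourier_add, add_apply, mul_add]

theorem hat_smul (c : ℂ) (f : 𝓢(Spacetime s, ℂ)) (p : Spacetime s) :
    hat (c • f) p = c * hat f p := by
  unfold hat
  rw [FourierTransform.fourier_smul, smul_apply, smul_eq_mul]
  ring

theorem hat_lineDeriv (f : 𝓢(Spacetime s, ℂ)) (μ : Fin (s + 1)) (p : Spacetime s) :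
    hat (∂_{EuclideanSpace.single μ (1 : ℝ)} f) p =
      Complex.I * ((eta μ * p μ : ℝ) : ℂ) * hat f p := by
  have hg : (fun x : Spacetime s => inner ℝ x (EuclideanSpace.single μ (1 : ℝ))).HasTemperateGrowth :=
    ((innerSL ℝ).flip (EuclideanSpace.single μ (1 : ℝ))).hasTemperateGrowth
  unfold hat
  rw [SchwartzMap.fourier_lineDerivOp_eq, smul_apply]
  have h := SchwartzMap.smulLeftCLM_apply_apply hg (𝓕 f)
    (Matrix.toEuclideanLin (freqMatrix s) p)
  rw [h, EuclideanSpace.inner_single_right, freqMatrix_apply, Complex.real_smul, smul_eq_mul]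
  have hpi : (Real.pi : ℂ) ≠ 0 := by exact_mod_cast Real.pi_ne_zero
  simp only [conj_trivial]
  push_cast
  field_simp

theorem exists_schwartz_hat (f : 𝓢(Spacetime s, ℂ)) :
    ∃ g : 𝓢(Spacetime s, ℂ), ∀ p, g p = hat f p := by
  obtain ⟨g, hg⟩ := exists_schwartz_comp isUnit_det_freqMatrix 0 (𝓕 f)
  refine ⟨(((2 * Real.pi) ^ (-((s : ℝ) + 1) / 2) : ℝ) : ℂ) • g, fun p => ?_⟩
  rw [smul_apply, hg, sub_zero, smul_eq_mul, hat]

/-- Multiplication of the Fourier transform by polynomials does not increase supports. -/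
theorem exists_hat_eq_eval_mul (f : 𝓢(Spacetime s, ℂ)) (q : MvPolynomial (Fin (s + 1)) ℂ) :
    ∃ g : 𝓢(Spacetime s, ℂ), tsupport g ⊆ tsupport f ∧
      ∀ p : Spacetime s, hat g p = MvPolynomial.eval (fun μ => (p μ : ℂ)) q * hat f p := by
  induction q using MvPolynomial.induction_on with
  | C c =>
    refine ⟨c • f, ?_, fun p => by rw [hat_smul, MvPolynomial.eval_C]⟩
    exact closure_mono (Function.support_const_smul_subset c f)
  | add q r hq hr =>
    obtain ⟨g, hg, hg'⟩ := hq
    obtain ⟨h, hh, hh'⟩ := hr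
    refine ⟨g + h, ?_, fun p => by rw [hat_add, hg', hh', map_add, add_mul]⟩
    refine (tsupport_add (g : Spacetime s → ℂ) h).trans (Set.union_subset hg hh)
  | mul_X q μ hq =>
    obtain ⟨g, hg, hg'⟩ := hq
    -- The derivative has symbol i η p^μ; the prefactor -i η removes both i and the metric sign.
    refine ⟨(-Complex.I * eta μ) • ∂_{EuclideanSpace.single μ (1 : ℝ)} g, ?_, fun p => ?_⟩
    · refine (closure_mono (Function.support_const_smul_subset _ _)).trans ?_
      exact (SchwartzMap.tsupport_lineDerivOp_subset _ g).trans hg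
    · rw [hat_smul, hat_lineDeriv, hg', map_mul, MvPolynomial.eval_X]
      have h : (eta μ : ℂ) * eta μ = 1 := by
        rw [← Complex.ofReal_mul, eta_mul_self, Complex.ofReal_one]
      push_cast
      linear_combination (-Complex.I * Complex.I * p μ *
        (MvPolynomial.eval (fun μ => (p μ : ℂ)) q * hat f p)) * h -
        (p μ * (MvPolynomial.eval (fun μ => (p μ : ℂ)) q * hat f p)) * Complex.I_mul_I

theorem fourier_algebraicTest {ι : Type*} [Fintype ι] (f : ι → 𝓢(Spacetime s, ℂ))
    (χ : ι → Fock₀ s) (p : Spacetime s) :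
    fourier (algebraicTest f χ) p = ∑ i, hat (f i) p • embed (χ i) := by
  unfold fourier
  have hcont : Continuous fun x : Spacetime s => Complex.exp (-Complex.I * (minkowski p x : ℂ)) := by
    unfold minkowski
    fun_prop
  have hint (i : ι) : Integrable fun x : Spacetime s =>
      Complex.exp (-Complex.I * (minkowski p x : ℂ)) * f i x := by
    refine (f i).integrable.bdd_mul (c := 1) hcont.aestronglyMeasurable
      (Filter.Eventually.of_forall fun x => ?_)
    rw [Complex.norm_exp]
    simp
  have h1 : (fun x => Complex.exp (-Complex.I * (minkowski p x : ℂ)) • algebraicTest f χ x) =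
      fun x => ∑ i, (Complex.exp (-Complex.I * (minkowski p x : ℂ)) * f i x) • embed (χ i) := by
    funext x
    rw [algebraicTest_apply, Finset.smul_sum]
    exact Finset.sum_congr rfl fun i _ => smul_smul _ _ _
  rw [h1, integral_finsetSum _ fun i _ => (hint i).smul_const _, Finset.smul_sum]
  refine Finset.sum_congr rfl fun i _ => ?_
  rw [integral_smul_const, smul_smul, hat_eq_integral]

theorem map_eval_eq_sum (Ξ : MvPolynomial (Mode s) (MvPolynomial (Fin (s + 1)) ℂ))
    (p : Spacetime s) : MvPolynomial.map (MvPolynomial.eval fun μ => (p μ : ℂ)) Ξ =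
      ∑ m : Ξ.support, MvPolynomial.eval (fun μ => (p μ : ℂ)) (Ξ.coeff m) •
        (MvPolynomial.monomial (m : Mode s →₀ ℕ) (1 : ℂ)) := by
  conv_lhs => rw [Ξ.as_sum]
  rw [map_sum, ← Finset.sum_coe_sort]
  refine Finset.sum_congr rfl fun m _ => ?_
  rw [MvPolynomial.map_monomial, MvPolynomial.smul_monomial, smul_eq_mul, mul_one]

/-- Polynomial vector fields times the Fourier transform of a test function are Fourier transforms
of algebraic test functions. -/
theorem exists_algebraicTest (f : 𝓢(Spacetime s, ℂ))
    (Ξ : MvPolynomial (Mode s) (MvPolynomial (Fin (s + 1)) ℂ)) :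
    ∃ F : 𝓢(Spacetime s, FockSpace s), IsAlgebraic F ∧ tsupport F ⊆ tsupport f ∧
      ∀ p, fourier F p = hat f p • embed
        (MvPolynomial.map (MvPolynomial.eval fun μ => (p μ : ℂ)) Ξ) := by
  choose g hg hg' using fun m : Ξ.support => exists_hat_eq_eval_mul f (Ξ.coeff m)
  refine ⟨algebraicTest g fun m => MvPolynomial.monomial m 1, isAlgebraic_algebraicTest _ _, ?_,
    fun p => ?_⟩
  · refine closure_minimal (fun x hx => ?_) (isClosed_tsupport _)
    by_contra h
    refine hx ?_
    rw [algebraicTest_apply]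
    refine Finset.sum_eq_zero fun m _ => ?_
    rw [image_eq_zero_of_notMem_tsupport fun h' => h (hg m h'), zero_smul]
  · rw [fourier_algebraicTest]
    rw [map_eval_eq_sum, map_sum, Finset.smul_sum]
    refine Finset.sum_congr rfl fun m _ => ?_
    rw [hg', map_smul, smul_smul, mul_comm]

/-- A polynomial times f̂ is again a Schwartz function, and only finitely many Fock components
occur. -/
theorem memLp_hat_smul_embed (hs : 2 ≤ s) {r : ℝ} (hr : 0 ≤ r) (f : 𝓢(Spacetime s, ℂ))
    (Ξ : MvPolynomial (Mode s) (MvPolynomial (Fin (s + 1)) ℂ)) :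
    MemLp (fun p => hat f p • embed
      (MvPolynomial.map (MvPolynomial.eval fun μ => (p μ : ℂ)) Ξ)) 2 (shellMeasure s r) := by
  have h (m : Ξ.support) : ∃ g : 𝓢(Spacetime s, ℂ), ∀ p : Spacetime s,
      g p = MvPolynomial.eval (fun μ => (p μ : ℂ)) (Ξ.coeff m) * hat f p := by
    obtain ⟨g, -, hg⟩ := exists_hat_eq_eval_mul f (Ξ.coeff m)
    obtain ⟨h, hh⟩ := exists_schwartz_hat g
    exact ⟨h, fun p => (hh p).trans (hg p)⟩
  choose g hg using h
  have h1 : (fun p => hat f p • embed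
      (MvPolynomial.map (MvPolynomial.eval fun μ => (p μ : ℂ)) Ξ)) =
      algebraicTest g fun m => MvPolynomial.monomial m 1 := by
    funext p
    rw [map_eval_eq_sum, map_sum, Finset.smul_sum, algebraicTest_apply]
    refine Finset.sum_congr rfl fun m _ => ?_
    rw [hg, map_smul, smul_smul, mul_comm]
  have h2 : MemLp (fun p => ∑ m, g m p • embed (MvPolynomial.monomial (m : Mode s →₀ ℕ) (1 : ℂ))) 2
      (shellMeasure s r) :=
    memLp_finsetSum _ fun m _ => (ContinuousLinearMap.toSpanSingleton ℂ _).comp_memLp'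
      (memLp_shellMeasure hs hr (g m))
  rw [h1]
  simpa only [← algebraicTest_apply] using h2

/-! ### Test functions with small support -/

/-- The time reflection `(x⁰, 𝐱) ↦ (-x⁰, 𝐱)`. -/
def timeReflection (s : ℕ) : Spacetime s ≃ₗᵢ[ℝ] Spacetime s where
  toLinearEquiv := LinearEquiv.ofInvolutive
    { toFun := fun x => -spaceReflection x
      map_add' := fun x y => by
        ext μ
        simp only [spaceReflection, PiLp.neg_apply, PiLp.add_apply]
        split_ifs <;> ring
      map_smul' := fun c x => by
        ext μ
        simp only [spaceReflection, PiLp.neg_apply, PiLp.smul_apply, smul_eq_mul, RingHom.id_apply]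
        split_ifs <;> ring }
    (fun x => by
      ext μ
      simp only [spaceReflection, LinearMap.coe_mk, AddHom.coe_mk, PiLp.neg_apply]
      split_ifs <;> ring)
  norm_map' := fun x => by
    change ‖-spaceReflection x‖ = ‖x‖
    rw [norm_neg, EuclideanSpace.norm_eq, EuclideanSpace.norm_eq]
    congr 1
    refine Finset.sum_congr rfl fun μ _ => ?_
    simp only [spaceReflection]
    split_ifs <;> simp

theorem minkowski_timeReflection (p x : Spacetime s) :
    minkowski (spaceReflection p) (timeReflection s x) = -minkowski p x := by
  change minkowski (spaceReflection p) (-spaceReflection x) = _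
  rw [← minkowski_spaceReflection p x]
  unfold minkowski
  rw [← Finset.sum_neg_distrib]
  refine Finset.sum_congr rfl fun μ _ => ?_
  rw [PiLp.neg_apply]
  ring

theorem abs_minkowski_le (p x : Spacetime s) : |minkowski p x| ≤ ‖p‖ * ‖x‖ := by
  have h : minkowski p x = inner ℝ (timeReflection s p) x := by
    rw [PiLp.inner_apply, minkowski]
    refine Finset.sum_congr rfl fun μ _ => ?_
    have h1 : timeReflection s p μ = eta μ * p μ := by
      change (-spaceReflection p) μ = _
      simp only [spaceReflection, eta, PiLp.neg_apply]
      split_ifs <;> ring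
    rw [h1, RCLike.inner_apply, conj_trivial]
    ring
  rw [h, ← (timeReflection s).norm_map p]
  exact abs_real_inner_le_norm _ _

/-- Support radius at most 1/C forces |p·x| ≤ 1 for ‖p‖ ≤ C, so the real part cos(p·x) φ(x) of the
integrand is nonnegative, and positive at 0. The symmetry holds because a real radial φ is invariant
under time reflection, which converts the phase at the reflected momentum into the conjugate phase.
-/
theorem exists_bump (R C : ℝ) (hR : 0 < R) (hC : 0 < C) :
    ∃ f : 𝓢(Spacetime s, ℂ), tsupport f ⊆ Metric.closedBall 0 R ∧
      (∀ p, conj (hat f (spaceReflection p)) = hat f p) ∧ ∀ p, ‖p‖ ≤ C → hat f p ≠ 0 := by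
  set ρ := min R C⁻¹ with hρ
  have hρ0 : 0 < ρ := lt_min hR (inv_pos.mpr hC)
  let φ : Spacetime s → ℝ := fun x => Real.smoothTransition (ρ ^ 2 - ‖x‖ ^ 2)
  have hφ : ContDiff ℝ (⊤ : ℕ∞) φ :=
    Real.smoothTransition.contDiff.comp (contDiff_const.sub (contDiff_norm_sq ℝ))
  have hφ0 (x : Spacetime s) : 0 ≤ φ x := Real.smoothTransition.nonneg _
  have hφz (x : Spacetime s) (hx : φ x ≠ 0) : ‖x‖ < ρ := by
    by_contra h
    refine hx (Real.smoothTransition.zero_of_nonpos ?_)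
    have : ρ ^ 2 ≤ ‖x‖ ^ 2 := by
      gcongr
      exact not_lt.mp h
    linarith
  have hsupp : tsupport φ ⊆ Metric.closedBall 0 ρ := by
    refine closure_minimal (fun x hx => ?_) Metric.isClosed_closedBall
    rw [mem_closedBall_zero_iff]
    exact (hφz x hx).le
  have hcs : HasCompactSupport φ := (isCompact_closedBall 0 ρ).of_isClosed_subset
    (isClosed_tsupport _) hsupp
  have hcs' : HasCompactSupport fun x => (φ x : ℂ) := hcs.comp_left Complex.ofReal_zero
  let f : 𝓢(Spacetime s, ℂ) :=
    hcs'.toSchwartzMap (Complex.ofRealCLM.contDiff.comp hφ)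
  have hf (x : Spacetime s) : f x = (φ x : ℂ) := rfl
  refine ⟨f, ?_, fun p => ?_, fun p hp h0 => ?_⟩
  · refine Set.Subset.trans ?_ (hsupp.trans (Metric.closedBall_subset_closedBall (min_le_left _ _)))
    refine closure_mono fun x hx => ?_
    simpa [hf] using hx
  · rw [hat_eq_integral, hat_eq_integral, map_mul, Complex.conj_ofReal, ← integral_conj]
    congr 1
    rw [← (timeReflection s).measurePreserving.integral_comp
      (timeReflection s).toHomeomorph.measurableEmbedding]
    refine integral_congr_ae (Filter.Eventually.of_forall fun x => ?_)
    have h1 : φ (timeReflection s x) = φ x := by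
      simp only [φ, LinearIsometryEquiv.norm_map]
    simp only [hf, h1, map_mul, Complex.conj_ofReal, ← Complex.exp_conj, map_neg, Complex.conj_I,
      minkowski_timeReflection]
    push_cast
    congr 2
    ring
  · rw [hat_eq_integral, mul_eq_zero] at h0
    have hc : (((2 * Real.pi) ^ (-((s : ℝ) + 1) / 2) : ℝ) : ℂ) ≠ 0 :=
      Complex.ofReal_ne_zero.mpr (Real.rpow_pos_of_pos (by positivity) _).ne'
    have hcont : Continuous fun x : Spacetime s => minkowski p x := by
      unfold minkowski
      fun_prop
    have h1 := h0.resolve_left hc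
    have hint : Integrable fun x : Spacetime s =>
        Complex.exp (-Complex.I * (minkowski p x : ℂ)) * f x := by
      refine f.integrable.bdd_mul (c := 1) (by fun_prop) (Filter.Eventually.of_forall fun x => ?_)
      rw [Complex.norm_exp]
      simp
    have h2 : ∫ x, Real.cos (minkowski p x) * φ x = 0 := by
      have h3 := congrArg Complex.re h1
      have h4 := integral_re hint
      simp only [RCLike.re_eq_complex_re] at h4
      rw [← h4] at h3
      rw [← h3.trans Complex.zero_re]
      refine integral_congr_ae (Filter.Eventually.of_forall fun x => ?_)
      have h5 : -Complex.I * (minkowski p x : ℂ) = ((-minkowski p x : ℝ) : ℂ) * Complex.I := by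
        push_cast
        ring
      simp only [hf, h5, Complex.re_mul_ofReal, Complex.exp_ofReal_mul_I_re, Real.cos_neg]
    have h3 : 0 < ∫ x, Real.cos (minkowski p x) * φ x := by
      refine Continuous.integral_pos_of_hasCompactSupport_nonneg_nonzero (x := 0)
        ((Real.continuous_cos.comp hcont).mul hφ.continuous) hcs.mul_left (fun x => ?_) ?_
      · by_cases hx : φ x = 0
        · simp [hx]
        · have h4 : |minkowski p x| ≤ 1 := by
            calc |minkowski p x| ≤ ‖p‖ * ‖x‖ := abs_minkowski_le p x
              _ ≤ C * C⁻¹ := by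
                gcongr
                exact (hφz x hx).le.trans (min_le_right _ _)
              _ = 1 := mul_inv_cancel₀ hC.ne'
          exact mul_nonneg (Real.cos_pos_of_le_one h4).le (hφ0 x)
      · have h4 : minkowski p 0 = 0 := by simp [minkowski]
        have h5 : 0 < φ 0 := Real.smoothTransition.pos_of_pos (by
          rw [norm_zero]
          nlinarith)
        simp only [h4, Real.cos_zero, one_mul]
        exact h5.ne'
    exact h3.ne' h2

end

section

/-! ### One-string vectors of a single mass -/

variable {s : ℕ} {b : ℝ} {n : ℕ}

/-- The one-string vector `ψ` has only the component at level `n`, and it is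
`p ↦ √(2π) f̂(p) ξ(p)` there. -/
def HasSymbol (n : ℕ) (f : 𝓢(Spacetime s, ℂ)) (ψ : OneStringPos s b)
    (ξ : Spacetime s → Fock₀ s) : Prop :=
  (∀ j, j ≠ n → (ψ : OneString s b) j = 0) ∧
    ((ψ : OneString s b) n : Spacetime s → FockSpace s)
      =ᵐ[shellMeasure s (massLevel b n)]
        fun p => (Real.sqrt (2 * Real.pi) : ℂ) • hat f p • embed (ξ p)

theorem massLevel_nonneg (h : b ≤ n) : 0 ≤ massLevel b n := by
  unfold massLevel
  linarith

theorem exists_hasSymbol (hs : 2 ≤ s) (hb : b ≤ n) (f : 𝓢(Spacetime s, ℂ))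
    (Ξ : MvPolynomial (Mode s) (MvPolynomial (Fin (s + 1)) ℂ)) :
    ∃ ψ : OneStringPos s b, HasSymbol n f ψ fun p =>
      MvPolynomial.map (MvPolynomial.eval fun μ => (p μ : ℂ)) Ξ := by
  have hn := massLevel_nonneg hb
  have h := (memLp_hat_smul_embed hs hn f Ξ).const_smul (Real.sqrt (2 * Real.pi) : ℂ)
  refine ⟨⟨lp.single 2 n (h.toLp _), fun j hj => ?_⟩, fun j hj => ?_, ?_⟩
  · refine lp.single_apply_ne 2 n _ ?_
    rintro rfl
    exact absurd hj (not_lt.mpr hn)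
  · exact lp.single_apply_ne 2 n _ hj
  · change (lp.single 2 n (h.toLp _) : OneString s b) n =ᵐ[_] _
    rw [lp.single_apply_self]
    exact h.coeFn_toLp

theorem HasSymbol.add {f : 𝓢(Spacetime s, ℂ)} {ψ φ : OneStringPos s b}
    {ξ ζ : Spacetime s → Fock₀ s} (hψ : HasSymbol n f ψ ξ) (hφ : HasSymbol n f φ ζ) :
    HasSymbol n f (ψ + φ) fun p => ξ p + ζ p := by
  refine ⟨fun j hj => ?_, ?_⟩
  · change (ψ : OneString s b) j + (φ : OneString s b) j = 0
    rw [hψ.1 j hj, hφ.1 j hj, add_zero]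
  · refine (Lp.coeFn_add ((ψ : OneString s b) n) ((φ : OneString s b) n)).trans ?_
    filter_upwards [hψ.2, hφ.2] with p h1 h2
    rw [Pi.add_apply, h1, h2, map_add, smul_add, smul_add]

theorem HasSymbol.smul {f : 𝓢(Spacetime s, ℂ)} {ψ : OneStringPos s b}
    {ξ : Spacetime s → Fock₀ s} (hψ : HasSymbol n f ψ ξ) (c : ℂ) :
    HasSymbol n f (c • ψ) fun p => c • ξ p := by
  refine ⟨fun j hj => ?_, ?_⟩
  · change c • (ψ : OneString s b) j = 0
    rw [hψ.1 j hj, smul_zero]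
  · refine (Lp.coeFn_smul c ((ψ : OneString s b) n)).trans ?_
    filter_upwards [hψ.2] with p h1
    rw [Pi.smul_apply, h1, map_smul, smul_comm c, smul_comm c]

theorem HasSymbol.mem_physicalPos {f : 𝓢(Spacetime s, ℂ)} {ψ : OneStringPos s b}
    {ξ : Spacetime s → Fock₀ s} (hψ : HasSymbol n f ψ ξ)
    (hξ : ∀ p, ξ p ∈ physicalVectors b n p) : ψ ∈ physicalPos s b := by
  intro j
  by_cases hj : j = n
  · subst hj
    filter_upwards [hψ.2] with p hp
    rw [hp, smul_smul, ← map_smul]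
    exact isPhysicalAt_embed (Submodule.smul_mem _ _ (hξ p))
  · rw [hψ.1 j hj]
    filter_upwards [Lp.coeFn_zero (FockSpace s) 2 (shellMeasure s (massLevel b j))] with p hp
    rw [hp]
    exact isPhysicalAt_zero b j p

/-- The symbol has sharp level n, so P_r fixes it at its own mass and annihilates it at every other.
-/
theorem HasSymbol.isProjection {f : 𝓢(Spacetime s, ℂ)} {ψ : OneStringPos s b}
    {ξ : Spacetime s → Fock₀ s} (hψ : HasSymbol n f ψ ξ)
    (hξ : ∀ p, ξ p ∈ physicalVectors b n p) {F : 𝓢(Spacetime s, FockSpace s)}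
    (hF : ∀ p, fourier F p = hat f p • embed (ξ p)) : IsProjection F ψ := by
  intro j _
  by_cases hj : j = n
  · subst hj
    filter_upwards [hψ.2] with p hp
    rw [hp, hF, map_smul, massProj_embed_self (hξ p).1]
  · rw [hψ.1 j hj]
    filter_upwards [Lp.coeFn_zero (FockSpace s) 2 (shellMeasure s (massLevel b j))] with p hp
    rw [hp, hF, map_smul, massProj_embed_of_ne hj (hξ p).1, smul_zero, smul_zero, Pi.zero_apply]

/-! ### Indefinite products of one-string vectors as shell integrals. -/

theorem krein_eq_inner {φ ψ : OneStringPos s b}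
    (hφ : ∀ j, j ≠ n → (φ : OneString s b) j = 0) :
    krein (φ : OneString s b) ψ =
      inner ℂ ((φ : OneString s b) n) (fundSymmK s b n ((ψ : OneString s b) n)) := by
  unfold krein
  rw [lp.inner_eq_tsum, tsum_eq_single n]
  · rfl
  · intro j hj
    rw [hφ j hj, inner_zero_left]

theorem inner_fundSymmK_ae {f : 𝓢(Spacetime s, ℂ)} {φ ψ : OneStringPos s b}
    {ζ ξ : Spacetime s → Fock₀ s} (hφ : HasSymbol n f φ ζ) (hψ : HasSymbol n f ψ ξ) :
    (fun p => inner ℂ (((φ : OneString s b) n : Spacetime s → FockSpace s) p)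
        ((fundSymmK s b n ((ψ : OneString s b) n) : Spacetime s → FockSpace s) p))
      =ᵐ[shellMeasure s (massLevel b n)]
        fun p => ((2 * Real.pi * ‖hat f p‖ ^ 2 : ℝ) : ℂ) * form (ζ p) (ξ p) := by
  have h := ContinuousLinearMap.coeFn_compLpL (𝕜 := ℂ) (fundSymm s) ((ψ : OneString s b) n)
  filter_upwards [hφ.2, hψ.2, h] with p h1 h2 h3
  have h4 : (fundSymmK s b n ((ψ : OneString s b) n) : Spacetime s → FockSpace s) p =
      fundSymm s (((ψ : OneString s b) n : Spacetime s → FockSpace s) p) := h3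
  rw [h4, h1, h2, map_smul, map_smul, inner_smul_left, inner_smul_left, inner_smul_right,
    inner_smul_right, Complex.conj_ofReal, form]
  have h5 : (Real.sqrt (2 * Real.pi) : ℂ) * Real.sqrt (2 * Real.pi) = (2 * Real.pi : ℝ) := by
    rw [← Complex.ofReal_mul, Real.mul_self_sqrt (by positivity)]
  have h6 : conj (hat f p) * hat f p = ((‖hat f p‖ ^ 2 : ℝ) : ℂ) := by
    rw [Complex.conj_mul', Complex.ofReal_pow]
  rw [Complex.ofReal_mul, ← h5, ← h6]
  ring

theorem krein_eq_integral {f : 𝓢(Spacetime s, ℂ)} {φ ψ : OneStringPos s b}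
    {ζ ξ : Spacetime s → Fock₀ s} (hφ : HasSymbol n f φ ζ) (hψ : HasSymbol n f ψ ξ) :
    krein (φ : OneString s b) ψ = ∫ p, ((2 * Real.pi * ‖hat f p‖ ^ 2 : ℝ) : ℂ) *
      form (ζ p) (ξ p) ∂(shellMeasure s (massLevel b n)) :=
  (krein_eq_inner hφ.1).trans
    ((L2.inner_def _ _).trans (integral_congr_ae (inner_fundSymmK_ae hφ hψ)))

theorem integrable_symbol {f : 𝓢(Spacetime s, ℂ)} {φ ψ : OneStringPos s b}
    {ζ ξ : Spacetime s → Fock₀ s} (hφ : HasSymbol n f φ ζ) (hψ : HasSymbol n f ψ ξ) :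
    Integrable (fun p => ((2 * Real.pi * ‖hat f p‖ ^ 2 : ℝ) : ℂ) * form (ζ p) (ξ p))
      (shellMeasure s (massLevel b n)) :=
  (L2.integrable_inner (𝕜 := ℂ) ((φ : OneString s b) n)
    (fundSymmK s b n ((ψ : OneString s b) n))).congr (inner_fundSymmK_ae hφ hψ)

theorem integral_ne_zero_of_shell {r : ℝ} (hr : 0 ≤ r) (G : Spacetime s → ℝ) (hG : ∀ p, 0 ≤ G p)
    (hint : Integrable (fun p => (G p : ℂ)) (shellMeasure s r)) (U : Set (Spacetime s))
    (hU : IsOpen U) (hGU : ∀ p ∈ U, 0 < G p)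
    (q₀ : EuclideanSpace ℝ (Fin s)) (hq₀ : 0 < ‖q₀‖ ^ 2 + r)
    (hmem : event (1 * Real.sqrt (‖q₀‖ ^ 2 + r)) q₀ ∈ U) :
    ∫ p, (G p : ℂ) ∂(shellMeasure s r) ≠ 0 := by
  intro h0
  have h3 : Integrable G (shellMeasure s r) := hint.re
  rw [integral_complex_ofReal, Complex.ofReal_eq_zero,
    integral_eq_zero_iff_of_nonneg hG h3] at h0
  obtain ⟨p, hp, hp0⟩ := exists_of_ae_shellMeasure hr h0 U hU q₀ hq₀ hmem
  exact (hGU p hp).ne' hp0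

/-- A vector whose symbol has nonnegative norm everywhere, and positive norm somewhere, is not
orthogonal to itself. -/
theorem HasSymbol.krein_self_ne_zero {f : 𝓢(Spacetime s, ℂ)} {ψ : OneStringPos s b}
    {ξ : Spacetime s → Fock₀ s} (hψ : HasSymbol n f ψ ξ) (hb : b ≤ n) (c : Spacetime s → ℝ)
    (hc : ∀ p, 0 ≤ c p) (hform : ∀ p, form (ξ p) (ξ p) = c p) (U : Set (Spacetime s))
    (hU : IsOpen U) (hcU : ∀ p ∈ U, 0 < c p) (hfU : ∀ p ∈ U, hat f p ≠ 0)
    (q₀ : EuclideanSpace ℝ (Fin s)) (hq₀ : 0 < ‖q₀‖ ^ 2 + massLevel b n)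
    (hmem : event (1 * Real.sqrt (‖q₀‖ ^ 2 + massLevel b n)) q₀ ∈ U) :
    krein (ψ : OneString s b) ψ ≠ 0 := by
  have h1 := krein_eq_integral hψ hψ
  have h2 := integrable_symbol hψ hψ
  simp only [hform, ← Complex.ofReal_mul] at h1 h2
  rw [h1]
  refine integral_ne_zero_of_shell (massLevel_nonneg hb) _
    (fun p => mul_nonneg (by positivity) (hc p)) h2 U hU (fun p hp => ?_) q₀ hq₀ hmem
  have h6 := norm_pos_iff.mpr (hfU p hp)
  have h7 := hcU p hp
  positivity

/-! ### The test functions -/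

theorem minkowski_single_left (i : Fin (s + 1)) (x : Spacetime s) :
    minkowski (EuclideanSpace.single i 1) x = eta i * x i := by
  unfold minkowski
  rw [Finset.sum_eq_single i]
  · simp
  · intro j _ hj
    simp [hj]
  · simp

theorem minkowski_add_left (p q x : Spacetime s) :
    minkowski (p + q) x = minkowski p x + minkowski q x := by
  unfold minkowski
  rw [← Finset.sum_add_distrib]
  refine Finset.sum_congr rfl fun μ _ => ?_
  rw [PiLp.add_apply]
  ring

theorem conjVec_smul (c : ℂ) (χ : Fock₀ s) : conjVec (c • χ) = conj c • conjVec χ := by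
  rw [MvPolynomial.smul_eq_C_mul, map_mul, conjVec_C, MvPolynomial.smul_eq_C_mul]

theorem isReal_of_conjVec {f : 𝓢(Spacetime s, ℂ)} {ξ : Spacetime s → Fock₀ s}
    (hf : ∀ p, conj (hat f (spaceReflection p)) = hat f p)
    (hξ : ∀ p, conjVec (ξ (spaceReflection p)) = ξ p) {F : 𝓢(Spacetime s, FockSpace s)}
    (hF : ∀ p, fourier F p = hat f p • embed (ξ p)) : IsReal F := by
  intro p
  rw [hF, hF, fibreConj_smul_embed, hf, hξ]

/-- There is a real constrained algebraic test function of level `n` supported in the ball of radius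
`R` whose field is a nonzero observable. -/
def ExistsObservable (s : ℕ) (b : ℝ) (n : ℕ) (R : ℝ) : Prop :=
  ∃ F : 𝓢(Spacetime s, FockSpace s),
    IsAlgebraic F ∧ IsReal F ∧ tsupport F ⊆ Metric.closedBall 0 R ∧ IsConstrained b F ∧
    ∃ ψ : OneStringPos s b, IsProjection F ψ ∧
      (∀ k, k ≠ n → (ψ : OneString s b) k = 0) ∧
      (ψ : OneString s b) ∉ spurious s b ∧
      InducesObservable (stringField ψ)

/-- The test function of a polynomial, real and physical symbol whose one-string vector is not
orthogonal to some physical vector. -/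
theorem exists_observable_testFunction {f : 𝓢(Spacetime s, ℂ)} {R : ℝ}
    (hfR : tsupport f ⊆ Metric.closedBall 0 R)
    (hf : ∀ p, conj (hat f (spaceReflection p)) = hat f p) {ξ : Spacetime s → Fock₀ s}
    {Ξ : MvPolynomial (Mode s) (MvPolynomial (Fin (s + 1)) ℂ)}
    (hΞ : ∀ p : Spacetime s, MvPolynomial.map (MvPolynomial.eval fun μ => (p μ : ℂ)) Ξ = ξ p)
    (hreal : ∀ p, conjVec (ξ (spaceReflection p)) = ξ p)
    (hphys : ∀ p, ξ p ∈ physicalVectors b n p) {ψ φ : OneStringPos s b}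
    (hψ : HasSymbol n f ψ ξ) (hφ : φ ∈ physicalPos s b)
    (hne : krein (φ : OneString s b) ψ ≠ 0) :
    ExistsObservable s b n R := by
  obtain ⟨F, hF, hsupp, hfour⟩ := exists_algebraicTest f Ξ
  simp only [hΞ] at hfour
  have hψ' := hψ.mem_physicalPos hphys
  have hproj := hψ.isProjection hphys hfour
  exact ⟨F, hF, isReal_of_conjVec hf hreal hfour, hsupp.trans hfR, ⟨ψ, hψ', hproj⟩, ψ, hproj,
    hψ.1, fun h => hne (h.2 φ hφ), inducesObservable_stringField hψ' hφ hne⟩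

/-- Take k = e₀ + e₁ and t = e₂, with q along the second space axis (space-time index 2), so that
k·(a, q) = -a. Two space directions are needed to make t orthogonal to k. -/
theorem exists_lightlike_and_transversal (hs : 2 ≤ s) :
    ∃ k t : Spacetime s, minkowski k k = 0 ∧ minkowski k t = 0 ∧ minkowski t t = 1 ∧
      Continuous (fun p => minkowski k p) ∧ ∃ q : EuclideanSpace ℝ (Fin s), ‖q‖ = 1 ∧
        ∀ a : ℝ, 0 < a → minkowski k (event a q) ≠ 0 := by
  obtain ⟨m, rfl⟩ : ∃ m, s = m + 2 := ⟨s - 2, by omega⟩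
  have h02 : (0 : Fin (m + 2 + 1)) ≠ Fin.succ 1 := (Fin.succ_ne_zero _).symm
  have h12 : (1 : Fin (m + 2 + 1)) ≠ Fin.succ 1 := by
    rw [← Fin.succ_zero_eq_one, Ne, Fin.succ_inj]
    exact Fin.zero_ne_one
  have hk (x : Spacetime (m + 2)) :
      minkowski (EuclideanSpace.single 0 1 + EuclideanSpace.single 1 1) x = -x 0 + x 1 := by
    simp [minkowski_add_left, minkowski_single_left, eta]
  refine ⟨EuclideanSpace.single 0 1 + EuclideanSpace.single 1 1,
    EuclideanSpace.single (Fin.succ 1) 1, ?_, ?_, ?_, ?_, EuclideanSpace.single 1 1, ?_,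
    fun a ha => ?_⟩
  · rw [hk]
    simp
  · rw [hk]
    simp only [PiLp.single_apply, if_neg h02, if_neg h12, neg_zero, add_zero]
  · rw [minkowski_single_left, eta, if_neg h02.symm]
    simp
  · simp only [hk]
    fun_prop
  · simp
  · rw [hk]
    have h1 : event a (EuclideanSpace.single (1 : Fin (m + 2)) (1 : ℝ)) 0 = a := rfl
    have h2 : event a (EuclideanSpace.single (1 : Fin (m + 2)) (1 : ℝ)) 1 = 0 := by
      change (EuclideanSpace.single (1 : Fin (m + 2)) (1 : ℝ)) 0 = 0
      simp
    rw [h1, h2, add_zero]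
    exact neg_ne_zero.mpr ha.ne'

/-- If both products vanished, so would their combination ⟨ψ, (ψ + ψ') + (ψ - ψ')⟩ = 2⟨ψ, ψ⟩. -/
theorem exists_krein_symmetrized_ne_zero (ψ ψ' : OneStringPos s b)
    (hpos : krein (ψ : OneString s b) ψ ≠ 0) :
    krein (ψ : OneString s b) (ψ + ψ' : OneStringPos s b) ≠ 0 ∨
      krein (ψ : OneString s b) (Complex.I • (ψ + (-1 : ℂ) • ψ') : OneStringPos s b) ≠ 0 := by
  by_contra! h
  obtain ⟨h1, h2⟩ := h
  simp only [Submodule.coe_add, Submodule.coe_smul] at h1 h2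
  unfold krein at h1 h2 hpos
  simp only [map_add, map_smul, inner_add_right, inner_smul_right] at h1 h2
  have h3 := (mul_eq_zero.mp h2).resolve_left Complex.I_ne_zero
  refine hpos ?_
  linear_combination (h1 + h3) / 2

theorem existsObservable (hs : 2 ≤ s) (b : ℝ) (n : ℕ) (hb : b ≤ n) (R : ℝ) (hR : 0 < R) :
    ExistsObservable s b n R := by
  have hr0 := massLevel_nonneg hb
  obtain ⟨k, t, hkk, hkt, htt, hmk, q₀, hq₀, hkq⟩ := exists_lightlike_and_transversal hs
  -- The shell point over the unit vector q₀ has squared Euclidean norm 2 + r, which is less than (3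
  -- + r)², so f̂ does not vanish near it.
  obtain ⟨f, hfR, hfreal, hfne⟩ := exists_bump (s := s) R (3 + massLevel b n) hR (by linarith)
  let χ : Spacetime s → Fock₀ s := transversal n k t
  let χ' : Spacetime s → Fock₀ s := transversal n (spaceReflection k) (spaceReflection t)
  obtain ⟨Ξ, hΞ⟩ := exists_polynomial_transversal n k t
  obtain ⟨Ξ', hΞ'⟩ := exists_polynomial_transversal n (spaceReflection k) (spaceReflection t)
  obtain ⟨ψ, hψ⟩ := exists_hasSymbol (n := n) hs hb f Ξ
  obtain ⟨ψ', hψ'⟩ := exists_hasSymbol (n := n) hs hb f Ξ'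
  simp only [hΞ] at hψ
  simp only [hΞ'] at hψ'
  have hχ (p) : χ p ∈ physicalVectors b n p := transversal_mem n k t p b hkk hkt
  have hχ' (p) : χ' p ∈ physicalVectors b n p :=
    transversal_mem n _ _ p b (by rw [minkowski_spaceReflection, hkk])
      (by rw [minkowski_spaceReflection, hkt])
  have hconj (p) : conjVec (χ (spaceReflection p)) = χ' p := by
    simp only [χ, χ', conjVec_transversal, spaceReflection_spaceReflection]
  have hconj' (p) : conjVec (χ' (spaceReflection p)) = χ p := by
    simp only [χ, χ', conjVec_transversal, spaceReflection_spaceReflection]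
  have hψphys := hψ.mem_physicalPos hχ
  have hpos : krein (ψ : OneString s b) ψ ≠ 0 := by
    choose c hc hc' hform using fun p => form_transversal_self n k t p hkk hkt htt
    refine hψ.krein_self_ne_zero hb c hc hform ({p | ‖p‖ < 3 + massLevel b n} ∩ {p | minkowski k p ≠ 0})
      ((isOpen_lt continuous_norm continuous_const).inter
        (isOpen_ne_fun hmk continuous_const)) (fun p hp => hc' p hp.2)
      (fun p hp => hfne p hp.1.le) q₀ (by rw [hq₀]; positivity) ⟨?_, ?_⟩
    · change ‖event _ _‖ < 3 + massLevel b n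
      refine lt_of_pow_lt_pow_left₀ 2 (by positivity) ?_
      rw [norm_event_sq, hq₀, one_mul, Real.sq_sqrt (by positivity)]
      nlinarith
    · refine hkq _ ?_
      rw [one_mul, hq₀]
      exact Real.sqrt_pos.mpr (by positivity)
  rcases exists_krein_symmetrized_ne_zero ψ ψ' hpos with h | h
  · refine exists_observable_testFunction (ξ := fun p => χ p + χ' p) (Ξ := Ξ + Ξ') hfR hfreal
      (fun p => ?_) (fun p => ?_) (fun p => add_mem (hχ p) (hχ' p)) (hψ.add hψ') hψphys h
    · rw [map_add, hΞ, hΞ']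
    · rw [map_add, hconj, hconj']
      exact add_comm _ _
  -- The real structure changes the sign of χ - χ'; the factor i restores reality by antilinearity.
  · refine exists_observable_testFunction (ξ := fun p => Complex.I • (χ p + (-1 : ℂ) • χ' p))
      (Ξ := MvPolynomial.C (MvPolynomial.C Complex.I) * (Ξ - Ξ')) hfR hfreal
      (fun p => ?_) (fun p => ?_)
      (fun p => Submodule.smul_mem _ _ (add_mem (hχ p) (Submodule.smul_mem _ _ (hχ' p))))
      ((hψ.add (hψ'.smul _)).smul _) hψphys h
    · rw [map_mul, map_sub, hΞ, hΞ', MvPolynomial.map_C, MvPolynomial.eval_C,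
        MvPolynomial.smul_eq_C_mul, neg_one_smul, sub_eq_add_neg]
    · rw [conjVec_smul, map_add, conjVec_smul, hconj, hconj', Complex.conj_I, map_neg, map_one,
        neg_smul, ← smul_neg]
      congr 1
      rw [neg_add, neg_one_smul, neg_one_smul, neg_neg]
      exact add_comm _ _

end

end StringField

end

open StringField in
theorem mainTheorem1 (s : ℕ) (hs : 2 ≤ s) (b : ℝ) :
    (∀ n : ℕ, b ≤ n → ∀ R : ℝ, 0 < R →
      ∃ F : 𝓢(Spacetime s, FockSpace s),
        IsAlgebraic F ∧ IsReal F ∧ tsupport F ⊆ Metric.closedBall 0 R ∧ IsConstrained b F ∧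
        ∃ ψ : OneStringPos s b, IsProjection F ψ ∧
          (∀ k, k ≠ n → (ψ : OneString s b) k = 0) ∧
          (ψ : OneString s b) ∉ spurious s b ∧
          InducesObservable (stringField ψ)) ∧
    (∀ F : 𝓢(Spacetime s, FockSpace s), IsAlgebraic F →
      ∀ (a : Spacetime s) (Λ : Matrix (Fin (s + 1)) (Fin (s + 1)) ℝ), IsLorentz Λ →
        ∃! G : 𝓢(Spacetime s, FockSpace s), IsAlgebraic G ∧ IsPoincareTransform a Λ F G) :=
  ⟨fun n hb R hR => existsObservable hs b n hb R hR, existsUnique_poincareTransform⟩
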